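/- Let $G$ be a (finite-dimensional, real) Lie group with Lie algebra $\mathfrak g$ (bracket of left-invariant vector fields), let $V$ be a finite-dimensional real vector space with a smooth representation of $G$, and let $K\subset G$ be a compact Lie subgroup with Lie algebra $\mathfrak k$ and normalized Haar measure $dk$. Let $$\mathsf C^p(G,V)=C^\infty(G^p,V),\qquad \mathsf C^q(\mathfrak g,V)=V\otimes\wedge^q\mathfrak g^*,\qquad \mathsf D^{p,q}=C^\infty(G^p\times G,\,V\otimes\wedge^q\mathfrak g^*)\qquad(p,q\ge 0),$$ with the horizontal differential $$(\delta\psi)(g_1,\dots,g_{p+1};g)=\psi(g_2,\dots,g_{p+1};g)+\sum_{i=1}^p(-1)^i\psi(g_1,\dots,g_ig_{i+1},\dots,g_{p+1};g)+(-1)^{p+1}\psi(g_1,\dots,g_p;g_{p+1}g)$$ and the vertical differential $\mathsf d=(-1)^p\mathsf d_{CE}$ on $\mathsf D^{p,\bullet}$, where $\mathsf d_{CE}$ is the Chevalley–Eilenberg differential of the $\mathfrak g$-module $C^\infty(G^p\times G,V)$ obtained by differentiating the $G$-action $(a\cdot\varphi)(g_1,\dots,g_p;g)=a\cdot\varphi(g_1,\dots,g_p;ga)$.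 Together with the coadjoint action on $\wedge\mathfrak g^*$ the same formula defines a $G$-action on $\mathsf D^{p,q}$. Let $\mathsf D^{p,q}_{K}\subset\mathsf D^{p,q}$ and $\mathsf C^q(\mathfrak g,V)_K\subset\mathsf C^q(\mathfrak g,V)$ be the $K$-basic elements: those that are $K$-invariant and annihilated by the contractions with all elements of $\mathfrak k$. Let $\mathsf i:\mathsf C^q(\mathfrak g,V)_K\to \mathsf D^{0,q}_K$ be the inclusion of constant functions, let $(\mathsf j f)(g_1,\dots,g_p;g)=g^{-1}\cdot f(g_1,\dots,g_p)$ for $f\in\mathsf C^p(G,V)$, and put $$(\mathsf h\psi)(g_1,\dots,g_{p-1};g)=(-1)^p\int_K\psi(g_1,\dots,g_{p-1},gk^{-1};k)\,dk\quad(\psi\in\mathsf D^{p,q}_K,\ p\ge1),\qquad \mathsf h=0\ \text{ on }\mathsf D_K^{0,q},$$ $$\mathsf p(\psi)=\int_K\psi(k)\,dk\ \text{ for }\psi\in\mathsf D^{0,q}_K,\qquad \mathsf p=0\ \text{ on }\mathsf D^{p,q}_K,\ p\ge1 .$$ Then the maps $$\delta:\mathsf D^{p,q}_K\to\mathsf D^{p+1,q}_K,\quad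 \mathsf d:\mathsf D^{p,q}_K\to\mathsf D^{p,q+1}_K,\quad \mathsf h:\mathsf D^{p+1,q}_K\to\mathsf D^{p,q}_K,$$ $$\mathsf i:\mathsf C^q(\mathfrak g,V)_K\to\mathsf D^{0,q}_K,\quad \mathsf p:\mathsf D^{0,q}_K\to\mathsf C^q(\mathfrak g,V)_K,\quad \mathsf j:\mathsf C^p(G,V)\to\mathsf D^{p,0}_K$$ are well defined; $\mathsf h$ is a horizontal homotopy operator, $\mathsf h\delta+\delta\mathsf h=1-\mathsf i\circ\mathsf p$ and $\mathsf p\circ\mathsf i=1$; and $1+\mathsf d\mathsf h$ is a bijection of $\bigoplus_{p+q=n}\mathsf D^{p,q}_K$ onto itself for every $n\ge 0$. Hence the van Est differentiation $$\mathrm{VE}_{G/K}=\mathsf p\circ(1+\mathsf d\mathsf h)^{-1}\circ\mathsf j:\ \mathsf C^p(G,V)\to\mathsf C^p(\mathfrak g,V)_{K}$$ is defined for every $p\ge0$; write $\mathrm{VE}_G=\mathrm{VE}_{G/\{e\}}$. For $0\le i\le p$ let $\mathrm{Av}^{(i)}$ be the averaging over $K$ (with respect to $dk$) for the $i$-th $G$-action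 on $C^\infty(G^p,V)$: for $p\ge1$, $$(a\cdot f)(g_1,\dots,g_p)=\begin{cases}f(a^{-1}g_1,g_2,\dots,g_p)& i=0,\\ f(g_1,\dots,g_ia,\,a^{-1}g_{i+1},\dots,g_p)&0<i<p,\\ a\cdot f(g_1,\dots,g_{p-1},g_pa)& i=p,\end{cases}$$ and for $p=0$ the given action on $C^\infty(G^0,V)=V$. Let $\mathrm{Av}=\mathrm{Av}^{(0)}\circ\cdots\circ\mathrm{Av}^{(p)}$. For $1\le i\le p$ let $\mathsf d^{(i)}$ be the Chevalley–Eilenberg differential on $C^\infty(G^p,V)\otimes\wedge\mathfrak g^*$ for the $G$-action $$(a\cdot f)(g_1,\dots,g_p)=a\cdot f(g_1,\dots,g_{i-1},\,g_ia,\,a^{-1}g_{i+1}a,\dots,a^{-1}g_pa).$$ Then for every $p\ge0$ and every $f\in C^\infty(G^p,V)$ one has $\mathrm{Av}(f)\in C^\infty(G^p,V)$, $$\mathrm{VE}_{G/K}(f)=\big(\mathsf d^{(1)}\cdots\mathsf d^{(p)}\,\mathrm{Av}(f)\big)\Big|_{(e,\dots,e)},$$ and in particular $\mathrm{VE}_{G/K}(f)=\mathrm{VE}_G(\mathrm{Av}(f))$.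 -/

import Mathlib

open scoped Manifold ContDiff

noncomputable section

namespace VanEst

open MeasureTheory

section LieAlgebraPart

variable (E : Type*) [NormedAddCommGroup E] [NormedSpace ℝ E]
  (G : Type*) [TopologicalSpace G] [ChartedSpace E G] [Group G]
  (V : Type*) [NormedAddCommGroup V] [NormedSpace ℝ V]

/-- The Lie algebra `𝔤 = T_e G`, with the bracket of left-invariant vector fields. -/
abbrev LieAlg : Type _ := GroupLieAlgebra 𝓘(ℝ, E) G

/-- Functions of `q` variables in `𝔤` with values in `V`. The elements of `V ⊗ ∧^q 𝔤^*` are those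
functions that satisfy `IsForm`. -/
abbrev Cochain (q : ℕ) : Type _ := (Fin q → LieAlg E G) → V

variable {E G V}

/-- `α` belongs to `V ⊗ ∧^q 𝔤^*`, that is, it is multilinear and alternating. -/
def IsForm {q : ℕ} (α : Cochain E G V q) : Prop :=
  ∃ β : LieAlg E G [⋀^Fin q]→ₗ[ℝ] V, ∀ ξ, α ξ = β ξ

variable (E) in
/-- The adjoint action of `a ∈ G` on `𝔤`: the differential at `e` of `x ↦ a x a⁻¹`. -/
def Ad (a : G) : LieAlg E G → LieAlg E G :=
  fun ξ => mfderiv 𝓘(ℝ, E) 𝓘(ℝ, E) (fun x : G => a * x * a⁻¹) 1 ξ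

variable (E) in
/-- The Lie algebra `𝔨 ⊆ 𝔤` of a closed subgroup `K`: the velocities at `t = 0` of the smooth
curves through `e` that stay in `K`. -/
def lieOf (K : Subgroup G) : Set (LieAlg E G) :=
  {ξ | ∃ γ : ℝ → G, ContMDiff 𝓘(ℝ, ℝ) 𝓘(ℝ, E) ∞ γ ∧ (∀ t, γ t ∈ K) ∧ γ 0 = 1 ∧
    (mfderiv 𝓘(ℝ, ℝ) 𝓘(ℝ, E) γ 0 (1 : ℝ) : E) = ξ}

/-- The action of `G` on `V ⊗ ∧^q 𝔤^*`: the given one on `V` and the coadjoint one on `∧ 𝔤^*`. -/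
def actForm (ρ : Representation ℝ G V) {q : ℕ} (a : G) (α : Cochain E G V q) : Cochain E G V q :=
  fun ξ => ρ a (α fun l => Ad E a⁻¹ (ξ l))

/-- `α` is annihilated by the contractions with the elements of `𝔨`
(for alternating `α` the slot does not matter). -/
def IsHorizontal (K : Subgroup G) {q : ℕ} (α : Cochain E G V q) : Prop :=
  ∀ ξ : Fin q → LieAlg E G, (∃ l, ξ l ∈ lieOf E K) → α ξ = 0

variable (E) in
/-- `C^q(𝔤, V)_{K-basic}`. -/
def lieBasic (ρ : Representation ℝ G V) (K : Subgroup G) (q : ℕ) : Set (Cochain E G V q) :=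
  {α | IsForm α ∧ (∀ k ∈ K, actForm ρ k α = α) ∧ IsHorizontal K α}

/-- The infinitesimal action of `ξ ∈ 𝔤` on functions `φ : X → V`, for an action `A` of `G` on such
functions: `(ξ · φ)(x)` is the derivative of `a ↦ (A a φ)(x)` at `a = e` in the direction `ξ`. -/
def infAct {X : Type*} (A : G → (X → V) → X → V) (ξ : LieAlg E G) (φ : X → V) (x : X) : V :=
  mfderiv 𝓘(ℝ, E) 𝓘(ℝ, V) (fun a : G => A a φ x) 1 ξ

/-- The term `∑_{i < j} (-1)^{i+j} α([ξ_i, ξ_j], ξ_0, …, ξ̂_i, …, ξ̂_j, …, ξ_q)` of the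
Chevalley-Eilenberg differential of a `q`-cochain. -/
def bracketTerm : {q : ℕ} → Cochain E G V q → Cochain E G V (q + 1)
  | 0, _ => fun _ => 0
  | q + 1, α => fun ξ => ∑ j : Fin (q + 2), ∑ i : Fin (q + 1),
      if i.castSucc < j then
        (-1 : ℝ) ^ (i.val + j.val) •
          α (Fin.cons ⁅ξ i.castSucc, ξ j⁆ (i.removeNth (j.removeNth ξ)))
      else 0

/-- The Chevalley-Eilenberg differential of the `𝔤`-module of (smooth) functions `X → V`, for the
`𝔤`-representation given by the infinitesimal action of `A`. A `q`-cochain with values in that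
module is written as a function on `X` with values in `q`-cochains:
`(dη)(ξ_0, …, ξ_q) = ∑_i (-1)^i ξ_i · η(…, ξ̂_i, …) + ∑_{i<j} (-1)^{i+j} η([ξ_i, ξ_j], …)`. -/
def dCE {X : Type*} (A : G → (X → V) → X → V) {q : ℕ} (η : X → Cochain E G V q) :
    X → Cochain E G V (q + 1) :=
  fun x ξ => ∑ i : Fin (q + 1), (-1 : ℝ) ^ i.val •
      infAct A (ξ i) (fun y => η y (i.removeNth ξ)) x
    + bracketTerm (η x) ξ

end LieAlgebraPart

section DoubleComplex

variable (E : Type*) [NormedAddCommGroup E] [NormedSpace ℝ E]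
  (G : Type*) [TopologicalSpace G] [ChartedSpace E G] [Group G]
  (V : Type*) [NormedAddCommGroup V] [NormedSpace ℝ V]

/-- `C^p(G, V) = C^∞(G^p, V)`. -/
def groupCochains (p : ℕ) : Set ((Fin p → G) → V) :=
  {f | ContMDiff (ModelWithCorners.pi fun _ : Fin p => 𝓘(ℝ, E)) 𝓘(ℝ, V) ∞ f}

/-- Functions on `G^p × G` with values in `q`-cochains. An element is written `ψ (g, x)`, with
`g = (g_1, …, g_p)` and `x` the last variable. -/
abbrev Dbl (p q : ℕ) : Type _ := (Fin p → G) × G → Cochain E G V q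

/-- Families `(ψ^{p,q})_{p,q}`. -/
abbrev Fam : Type _ := ∀ p q : ℕ, Dbl E G V p q

variable {E G V}

/-- The action `(a · φ)(g_1, …, g_p; x) = a · φ(g_1, …, g_p; x a)` on functions
`G^p × G → V`. -/
def rightAct (ρ : Representation ℝ G V) {p : ℕ} (a : G) (φ : (Fin p → G) × G → V) :
    (Fin p → G) × G → V :=
  fun y => ρ a (φ (y.1, y.2 * a))

variable (E) in
/-- `D^{p,q}(G, V)_{K-basic}`: the smooth functions `G^p × G → V ⊗ ∧^q 𝔤^*` that are `K`-invariant
under `(a · ψ)(g_1, …, g_p; x) = a · ψ(g_1, …, g_p; x a)` and `𝔨`-horizontal. As `𝔤` is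
finite-dimensional, smoothness may be tested on fixed arguments from `𝔤`. -/
def dblBasic (ρ : Representation ℝ G V) (K : Subgroup G) (p q : ℕ) : Set (Dbl E G V p q) :=
  {ψ | (∀ y, IsForm (ψ y)) ∧
    (∀ ξ, ContMDiff ((ModelWithCorners.pi fun _ : Fin p => 𝓘(ℝ, E)).prod 𝓘(ℝ, E)) 𝓘(ℝ, V) ∞
      fun y => ψ y ξ) ∧
    (∀ k ∈ K, ∀ g x, actForm ρ k (ψ (g, x * k)) = ψ (g, x)) ∧
    (∀ y, IsHorizontal K (ψ y))}

/-- The horizontal differential `δ : D^{p,q} → D^{p+1,q}`. -/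
def dHor {p q : ℕ} (ψ : Dbl E G V p q) : Dbl E G V (p + 1) q :=
  fun y => ψ (Fin.tail y.1, y.2)
    + ∑ i : Fin p, (-1 : ℝ) ^ (i.val + 1) •
        ψ (Fin.contractNth i.castSucc (fun a b => a * b) y.1, y.2)
    + (-1 : ℝ) ^ (p + 1) • ψ (Fin.init y.1, y.1 (Fin.last p) * y.2)

/-- The vertical differential `d = (-1)^p d_CE : D^{p,q} → D^{p,q+1}`. -/
def dVer (ρ : Representation ℝ G V) {p q : ℕ} (ψ : Dbl E G V p q) : Dbl E G V p (q + 1) :=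
  (-1 : ℝ) ^ p • dCE (rightAct ρ) ψ

/-- The horizontal augmentation `i : C^q(𝔤, V) → D^{0,q}`. -/
def iAug {q : ℕ} (α : Cochain E G V q) : Dbl E G V 0 q := fun _ => α

variable (E) in
/-- The vertical augmentation `j : C^p(G, V) → D^{p,0}`,
`(j f)(g_1, …, g_p; x) = x⁻¹ · f(g_1, …, g_p)`. -/
def jAug (ρ : Representation ℝ G V) {p : ℕ} (f : (Fin p → G) → V) : Dbl E G V p 0 :=
  fun y _ => ρ y.2⁻¹ (f y.1)

variable (E) in
/-- `Tot^n(D(G, V)_{K-basic}) = ⊕_{p+q=n} D^{p,q}(G, V)_{K-basic}`. -/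
def totBasic (ρ : Representation ℝ G V) (K : Subgroup G) (n : ℕ) : Set (Fam E G V) :=
  {ψ | ∀ p q, ψ p q ∈ dblBasic E ρ K p q ∧ (p + q ≠ n → ψ p q = 0)}

/-- An element of `D^{p,q}` as a family concentrated in that bidegree. -/
def inBidegree (p q : ℕ) (ψ : Dbl E G V p q) : Fam E G V := Pi.single p (Pi.single q ψ)

/-- The `i`-th action of `G` on functions `G^p → V`, `0 ≤ i ≤ p`: `g_i` is replaced by `g_i a`
(if `i ≥ 1`), `g_{i+1}` by `a⁻¹ g_{i+1}` (if `i < p`), and for `i = p` the value is acted on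
by `a`. The entry `g_{l+1}` is `g l`. -/
def act (ρ : Representation ℝ G V) {p : ℕ} (i : Fin (p + 1)) (a : G) (f : (Fin p → G) → V) :
    (Fin p → G) → V :=
  fun g =>
    let v := f fun l : Fin p =>
      if l.val + 1 = i.val then g l * a else if l.val = i.val then a⁻¹ * g l else g l
    if i = Fin.last p then ρ a v else v

/-- The diagonal action of the actions labelled `i, i + 1, …, p` (for `1 ≤ i ≤ p`):
`(a · f)(g_1, …, g_p) = a · f(g_1, …, g_i a, a⁻¹ g_{i+1} a, …, a⁻¹ g_p a)`. -/
def diagAct (ρ : Representation ℝ G V) {p : ℕ} (i : ℕ) (a : G) (f : (Fin p → G) → V) :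
    (Fin p → G) → V :=
  fun g => ρ a (f fun l : Fin p =>
    if l.val + 1 < i then g l else if l.val + 1 = i then g l * a else a⁻¹ * g l * a)

variable (E) in
/-- `d^{(p-m+1)} ⋯ d^{(p)} f`, where `d^{(i)}` is the Chevalley-Eilenberg differential on
`C^∞(G^p, V) ⊗ ∧ 𝔤^*` for the `i`-th diagonal action. For `m = p` it is `d^{(1)} ⋯ d^{(p)} f`. -/
def dIter (ρ : Representation ℝ G V) {p : ℕ} (f : (Fin p → G) → V) :
    (m : ℕ) → (Fin p → G) → Cochain E G V m
  | 0 => fun g _ => f g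
  | m + 1 => dCE (diagAct ρ (p - m)) (dIter ρ f m)

variable [LieGroup 𝓘(ℝ, E) ∞ G] [MeasurableSpace G] [BorelSpace G]

variable (E) in
/-- The Haar measure of total mass one on the compact subgroup `K`. -/
def haarK (K : Subgroup G) [CompactSpace K] : Measure K :=
  haveI : IsTopologicalGroup G := topologicalGroup_of_lieGroup 𝓘(ℝ, E) ∞
  Measure.haarMeasure ⊤

/-- The homotopy operator `h : D^{p+1,q} → D^{p,q}` (it is zero on `D^{0,q}`),
`(h ψ)(g_1, …, g_p; x) = (-1)^{p+1} ∫_K ψ(g_1, …, g_p, x k⁻¹; k) dk`. -/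
def hK (K : Subgroup G) [CompactSpace K] {p q : ℕ} (ψ : Dbl E G V (p + 1) q) : Dbl E G V p q :=
  fun y ξ => (-1 : ℝ) ^ (p + 1) •
    ∫ k : K, ψ (Fin.snoc y.1 (y.2 * (k : G)⁻¹), (k : G)) ξ ∂(haarK E K)

/-- The projection `D^{0,q} → C^q(𝔤, V)`, `ψ ↦ ∫_K ψ(k) dk`. -/
def prK (K : Subgroup G) [CompactSpace K] {q : ℕ} (ψ : Dbl E G V 0 q) : Cochain E G V q :=
  fun ξ => ∫ k : K, ψ (Fin.elim0, (k : G)) ξ ∂(haarK E K)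

/-- The operator `d h` on families; its component in bidegree `(p, q + 1)` is `d h ψ^{p+1,q}`. -/
def dh (ρ : Representation ℝ G V) (K : Subgroup G) [CompactSpace K] (ψ : Fam E G V) :
    Fam E G V
  | _, 0 => 0
  | p, q + 1 => dVer ρ (hK K (ψ (p + 1) q))

/-- The operator `1 + d h`. -/
def oneAddDh (ρ : Representation ℝ G V) (K : Subgroup G) [CompactSpace K] (ψ : Fam E G V) :
    Fam E G V :=
  ψ + dh ρ K ψ

variable (E) in
/-- `VE_{G/K} = p ∘ (1 + d h)⁻¹ ∘ j` in degree `p`. Here `(1 + d h)⁻¹` is the inverse of `1 + d h`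
on `Tot^p(D(G, V)_{K-basic})`, and the projection sees only the component in bidegree `(0, p)`. -/
def VE (ρ : Representation ℝ G V) (K : Subgroup G) [CompactSpace K] {p : ℕ}
    (f : (Fin p → G) → V) : Cochain E G V p :=
  prK K (Function.invFunOn (oneAddDh ρ K) (totBasic E ρ K p) (inBidegree p 0 (jAug E ρ f)) 0 p)

variable (E) in
/-- `Av^{(i)}`: averaging over the `i`-th action of `K`. -/
def avAt (ρ : Representation ℝ G V) (K : Subgroup G) [CompactSpace K] {p : ℕ} (i : Fin (p + 1))
    (f : (Fin p → G) → V) : (Fin p → G) → V :=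
  fun g => ∫ k : K, act ρ i (k : G) f g ∂(haarK E K)

variable (E) in
/-- `Av = Av^{(0)} ∘ ⋯ ∘ Av^{(p)}`. -/
def Av (ρ : Representation ℝ G V) (K : Subgroup G) [CompactSpace K] {p : ℕ}
    (f : (Fin p → G) → V) : (Fin p → G) → V :=
  (List.finRange (p + 1)).foldr (avAt E ρ K) f

end DoubleComplex

end VanEst

end

/-! The operator `dh` removes one group argument and raises the form degree by one, so `(1 + dh) ψ =
χ` has a unique solution, found by recursion on the form degree. For `χ = j f` the solution is a
staircase `Ψ^{p,0} = j f`, `Ψ^{n,m+1} = -d h Ψ^{n+1,m}`, and `VE f` is the `K`-average of `Ψ^{0,p}`.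

The formula comes from descending the staircase with the invariant (`integral_staircase`) `∫
Ψ^{n+1,m}(g, x k⁻¹; k) dk = (d^{(n+2)} ⋯ d^{(p)} Av^{(n+1)} ⋯ Av^{(p)} f)(g, x, e, …, e)`, with `n +
1 + m = p`. Three facts carry it down one step. At points `(g, x, e, …, e)` the diagonal action
number `n + 1` only right translates `x`, because conjugation fixes `e`; hence the vertical
differential becomes `d^{(n+1)}` (`dCE_diagAct_padded`). Passing from `(g, x, e, …)` to `(g, x k⁻¹,
k, e, …)` is the action of `k⁻¹` in place `n + 1`, so the integral in `h` is an average `Av^{(n+1)}`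
(`shift_padded`). Finally `Av^{(i)}` commutes with `d^{(j)}` for `i < j` (`dIter_avAt`): the
underlying actions commute, and one may differentiate under an integral over a compact group. For
trivial `K` all averages disappear, which gives `VE_{G/K} f = VE_G (Av f)`.

The homotopy identity is a count of faces. In the claim that the operators preserve basic elements,
the substantial case is `d`. It rests on the derivative of `Ad` along a curve through `e` being the
bracket (`hasDerivAt_Ad`): this makes `Ad` respect brackets, hence `d` equivariant, and gives
Cartan's formula, hence horizontality. -/

open scoped Manifold ContDiff

noncomputable section

set_option linter.unusedSectionVars false

namespace VanEst

open MeasureTheory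

/-! ### Smooth structure on the powers of the group -/

section PiManifold

variable {E : Type*} [NormedAddCommGroup E] [NormedSpace ℝ E]
  {G : Type*} [TopologicalSpace G] [ChartedSpace E G]

variable (E) in
/-- The model with corners of `G^p`, for `G` modelled on `E`. -/
abbrev powModel (p : ℕ) : ModelWithCorners ℝ (Fin p → E) (ModelPi fun _ : Fin p => E) :=
  ModelWithCorners.pi fun _ : Fin p => 𝓘(ℝ, E)

instance boundaryless_powModel (p : ℕ) : (powModel E p).Boundaryless where
  range_eq_univ := Set.range_eq_univ.2 fun x => ⟨x, rfl⟩

instance isManifold_pow [IsManifold 𝓘(ℝ, E) ∞ G] (p : ℕ) :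
    IsManifold (powModel E p) ∞ (Fin p → G) := by
  apply isManifold_of_contDiffOn
  rintro _ _ ⟨e, he, rfl⟩ ⟨e', he', rfl⟩
  refine contDiffOn_pi.2 fun i => ?_
  have h : ContDiffOn ℝ ∞ ((e i).symm ≫ₕ e' i) ((e i).symm ≫ₕ e' i).source := by
    have h := (mem_groupoid_of_pregroupoid.1
      (HasGroupoid.compatible (G := contDiffGroupoid ∞ 𝓘(ℝ, E)) (he i trivial) (he' i trivial))).1
    simpa [contDiffPregroupoid, Function.comp_def] using h
  refine h.comp (contDiff_apply ℝ E i).contDiffOn ?_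
  intro x hx
  have h1 : ∀ j, x j ∈ (e j).target := fun j => hx.1.1 j trivial
  exact ⟨h1 i, hx.1.2 i trivial⟩

variable {F : Type*} [NormedAddCommGroup F] [NormedSpace ℝ F] {H : Type*} [TopologicalSpace H]
  {J : ModelWithCorners ℝ F H} {N : Type*} [TopologicalSpace N] [ChartedSpace H N]

theorem contMDiff_powModel {p : ℕ} {f : N → Fin p → G}
    (h : ∀ i, ContMDiff J 𝓘(ℝ, E) ∞ fun x => f x i) : ContMDiff J (powModel E p) ∞ f := by
  intro x
  rw [contMDiffAt_iff]
  refine ⟨continuousAt_pi.2 fun i => (h i x).continuousAt, contDiffWithinAt_pi.2 fun i => ?_⟩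
  exact (contMDiffAt_iff.1 (h i x)).2

theorem contMDiff_eval {p : ℕ} (i : Fin p) :
    ContMDiff (powModel E p) 𝓘(ℝ, E) ∞ fun g : Fin p → G => g i := by
  intro x
  rw [contMDiffAt_iff]
  refine ⟨(continuous_apply i).continuousAt, ?_⟩
  refine ((contDiff_apply ℝ E i).contDiffWithinAt).congr_of_eventuallyEq_of_mem (s := Set.range (powModel E p)) ?_
    ⟨_, rfl⟩
  rw [ModelWithCorners.range_eq_univ, nhdsWithin_univ]
  filter_upwards [extChartAt_target_mem_nhds x] with y hy
  exact (chartAt E (x i)).right_inv (hy.2 i trivial)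

end PiManifold

theorem integrable_of_continuous {K : Type*} [TopologicalSpace K] [CompactSpace K]
    [MeasurableSpace K] [OpensMeasurableSpace K] (μ : Measure K) [IsFiniteMeasure μ]
    {V : Type*} [NormedAddCommGroup V] {f : K → V} (hf : Continuous f) : Integrable f μ :=
  hf.integrable_of_hasCompactSupport (HasCompactSupport.of_compactSpace f)

/-! ### Smoothness of integrals depending on a parameter -/

section ParametricIntegral

variable {X : Type*} [NormedAddCommGroup X] [NormedSpace ℝ X]
  {E : Type*} [NormedAddCommGroup E] [NormedSpace ℝ E]
  {G : Type*} [TopologicalSpace G] [ChartedSpace E G] [IsManifold 𝓘(ℝ, E) ∞ G]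
  {V : Type*} [NormedAddCommGroup V] [NormedSpace ℝ V]

omit [IsManifold 𝓘(ℝ, E) ∞ G] in
theorem contMDiffAt_fderiv {F : Type*} [NormedAddCommGroup F] [NormedSpace ℝ F] {H : Type*}
    [TopologicalSpace H] {J : ModelWithCorners ℝ F H} {N : Type*} [TopologicalSpace N]
    [ChartedSpace H N] [IsManifold J ∞ N] {f : N → X → V} {g : N → X} {x : N}
    (hf : ContMDiffAt (J.prod 𝓘(ℝ, X)) 𝓘(ℝ, V) ∞ (Function.uncurry f) (x, g x))
    (hg : ContMDiffAt J 𝓘(ℝ, X) ∞ g x) :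
    ContMDiffAt J 𝓘(ℝ, X →L[ℝ] V) ∞ (fun y => fderiv ℝ (f y) (g y)) x := by
  have : IsManifold J 1 N := IsManifold.of_le (n := ∞) (by simp)
  have h := ContMDiffAt.mfderiv (J := J) (I := 𝓘(ℝ, X)) (I' := 𝓘(ℝ, V))
    (m := ∞) (n := ∞) f g hf hg (by simp)
  have e := inTangentCoordinates_model_space (I := 𝓘(ℝ, X)) (I' := 𝓘(ℝ, V))
    g (fun z => f z (g z)) (fun z => fderiv ℝ (f z) (g z)) x
  refine h.congr_of_eventuallyEq (.of_eq ?_)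
  rw [← e]
  simp only [mfderiv_eq_fderiv]

theorem contMDiffAt_fderiv_fst {F : X × G → V} {z : X × G}
    (hF : ContMDiffAt (𝓘(ℝ, X).prod 𝓘(ℝ, E)) 𝓘(ℝ, V) ∞ F z) :
    ContMDiffAt (𝓘(ℝ, X).prod 𝓘(ℝ, E)) 𝓘(ℝ, X →L[ℝ] V) ∞
      (fun z : X × G => fderiv ℝ (fun w => F (w, z.2)) z.1) z := by
  refine contMDiffAt_fderiv (f := fun (z : X × G) (w : X) => F (w, z.2)) (g := Prod.fst) ?_
    contMDiffAt_fst
  refine ContMDiffAt.comp (z, z.1) (g := F) (f := fun y : (X × G) × X => (y.2, y.1.2)) hF ?_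
  exact contMDiffAt_snd.prodMk (contMDiffAt_snd.comp _ contMDiffAt_fst)

variable {K : Type*} [TopologicalSpace K] [CompactSpace K] [MeasurableSpace K]
  [OpensMeasurableSpace K] (μ : Measure K) [IsFiniteMeasure μ] [FiniteDimensional ℝ X]
  [FiniteDimensional ℝ V] {ι : K → G}

/-- The partial derivative in `u` is jointly continuous, hence bounded on the product of a closed
ball and the compact `K`, and that constant dominates. `K` needs no smooth structure: it enters only
through a continuous map to the manifold `G`, on which the integrand is smooth. -/
theorem hasFDerivAt_integral_of_contMDiffOn {U : Set X} (hU : IsOpen U) {F : X × G → V}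
    (hF : ContMDiffOn (𝓘(ℝ, X).prod 𝓘(ℝ, E)) 𝓘(ℝ, V) ∞ F (U ×ˢ Set.univ))
    (hι : Continuous ι) {u : X} (hu : u ∈ U) :
    HasFDerivAt (fun u => ∫ k, F (u, ι k) ∂μ)
      (∫ k, fderiv ℝ (fun w => F (w, ι k)) u ∂μ) u := by
  have hUG : IsOpen (U ×ˢ (Set.univ : Set G)) := hU.prod isOpen_univ
  have hF' : ∀ z ∈ U ×ˢ (Set.univ : Set G),
      ContMDiffAt (𝓘(ℝ, X).prod 𝓘(ℝ, E)) 𝓘(ℝ, V) ∞ F z :=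
    fun z hz => hF.contMDiffAt (hUG.mem_nhds hz)
  have hcont : ∀ w ∈ U, Continuous fun k => F (w, ι k) := fun w hw =>
    hF.continuousOn.comp_continuous (continuous_const.prodMk hι) fun k => ⟨hw, trivial⟩
  have hDF : ContinuousOn (fun z : X × G => fderiv ℝ (fun w => F (w, z.2)) z.1)
      (U ×ˢ (Set.univ : Set G)) := fun z hz =>
    (contMDiffAt_fderiv_fst (hF' z hz)).continuousAt.continuousWithinAt
  obtain ⟨r, hr, hrU⟩ := Metric.nhds_basis_closedBall.mem_iff.1 (hU.mem_nhds hu)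
  have hDK : ContinuousOn (fun z : X × K => fderiv ℝ (fun w => F (w, ι z.2)) z.1)
      (Metric.closedBall u r ×ˢ (Set.univ : Set K)) :=
    hDF.comp (f := fun z : X × K => (z.1, ι z.2)) (by fun_prop) fun z hz => ⟨hrU hz.1, trivial⟩
  obtain ⟨C, hC⟩ := ((isCompact_closedBall u r).prod isCompact_univ).exists_bound_of_continuousOn
    hDK
  refine hasFDerivAt_integral_of_dominated_of_fderiv_le (Metric.closedBall_mem_nhds u hr)
    (bound := fun _ => C) (F := fun u k => F (u, ι k))
    (F' := fun u k => fderiv ℝ (fun w => F (w, ι k)) u) ?_ (integrable_of_continuous μ (hcont u hu)) ?_ ?_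
    (integrable_const C) ?_
  · filter_upwards [hU.mem_nhds hu] with w hw
    exact (hcont w hw).aestronglyMeasurable
  · have h : Continuous fun k => fderiv ℝ (fun w => F (w, ι k)) u :=
      hDF.comp_continuous (f := fun k => (u, ι k)) (continuous_const.prodMk hι)
        fun k => ⟨hu, trivial⟩
    exact h.aestronglyMeasurable
  · exact .of_forall fun k w hw => hC (w, k) ⟨hw, trivial⟩
  · refine .of_forall fun k w hw => DifferentiableAt.hasFDerivAt ?_
    have h1 : ContMDiffAt 𝓘(ℝ, X) (𝓘(ℝ, X).prod 𝓘(ℝ, E)) ∞ (fun w => (w, ι k)) w :=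
      contMDiffAt_id.prodMk contMDiffAt_const
    have h := ContMDiffAt.comp w (hF' (w, ι k) ⟨hrU hw, trivial⟩) h1
    exact h.contDiffAt.differentiableAt (by simp)

/-- The derivative of the integral is the integral of the derivative, which is again an integral of
the same kind. Applying it to a fixed vector keeps the values in `V`, so that the induction can be
repeated. -/
theorem contDiffOn_integral_of_contMDiffOn {U : Set X} (hU : IsOpen U) {F : X × G → V}
    (hF : ContMDiffOn (𝓘(ℝ, X).prod 𝓘(ℝ, E)) 𝓘(ℝ, V) ∞ F (U ×ˢ Set.univ))
    (hι : Continuous ι) : ContDiffOn ℝ ∞ (fun u => ∫ k, F (u, ι k) ∂μ) U := by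
  have hUG : IsOpen (U ×ˢ (Set.univ : Set G)) := hU.prod isOpen_univ
  refine contDiffOn_infty.2 fun n => ?_
  induction n generalizing F with
  | zero =>
    exact contDiffOn_zero.2 fun u hu =>
      (hasFDerivAt_integral_of_contMDiffOn μ hU hF hι hu).continuousAt.continuousWithinAt
  | succ n ih =>
    refine (contDiffOn_succ_iff_fderiv_of_isOpen hU).2 ⟨fun u hu =>
      (hasFDerivAt_integral_of_contMDiffOn μ hU hF hι hu).differentiableAt.differentiableWithinAt,
      fun h => absurd h (WithTop.natCast_ne_top n), contDiffOn_clm_apply.2 fun v => ?_⟩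
    have hDF : ContMDiffOn (𝓘(ℝ, X).prod 𝓘(ℝ, E)) 𝓘(ℝ, X →L[ℝ] V) ∞
        (fun z : X × G => fderiv ℝ (fun w => F (w, z.2)) z.1) (U ×ˢ (Set.univ : Set G)) :=
      fun z hz =>
        (contMDiffAt_fderiv_fst (hF.contMDiffAt (hUG.mem_nhds hz))).contMDiffWithinAt
    refine (ih (F := fun z => fderiv ℝ (fun w => F (w, z.2)) z.1 v)
      (hDF.clm_apply contMDiffOn_const)).congr fun u hu => ?_
    rw [(hasFDerivAt_integral_of_contMDiffOn μ hU hF hι hu).fderiv,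
      ContinuousLinearMap.integral_apply]
    exact integrable_of_continuous μ (hDF.continuousOn.comp_continuous
      (continuous_const.prodMk hι) fun k => ⟨hu, trivial⟩)

theorem contMDiff_integral {H : Type*} [TopologicalSpace H] {J : ModelWithCorners ℝ X H}
    [J.Boundaryless] {N : Type*} [TopologicalSpace N] [ChartedSpace H N] [IsManifold J ∞ N]
    {F : N × G → V} (hF : ContMDiff (J.prod 𝓘(ℝ, E)) 𝓘(ℝ, V) ∞ F) (hι : Continuous ι) :
    ContMDiff J 𝓘(ℝ, V) ∞ fun x => ∫ k, F (x, ι k) ∂μ := by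
  intro x
  have hU : IsOpen (extChartAt J x).target := isOpen_extChartAt_target x
  have hx := mem_extChartAt_target (I := J) x
  have hsm : ContDiffOn ℝ ∞ (fun u => ∫ k, F ((extChartAt J x).symm u, ι k) ∂μ)
      (extChartAt J x).target := by
    have h1 : ContMDiffOn (𝓘(ℝ, X).prod 𝓘(ℝ, E)) (J.prod 𝓘(ℝ, E)) ∞
        (fun z : X × G => ((extChartAt J x).symm z.1, z.2))
        ((extChartAt J x).target ×ˢ Set.univ) :=
      ((contMDiffOn_extChartAt_symm x).comp contMDiffOn_fst fun z hz => hz.1).prodMk contMDiffOn_snd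
    exact contDiffOn_integral_of_contMDiffOn μ hU (hF.comp_contMDiffOn h1) hι
  have h := (hsm.contDiffAt (hU.mem_nhds hx)).contMDiffAt.comp x (contMDiffAt_extChartAt (I := J))
  refine h.congr_of_eventuallyEq ?_
  filter_upwards [extChartAt_source_mem_nhds (I := J) x] with y hy
  simp only [Function.comp_apply, (extChartAt J x).left_inv hy]

end ParametricIntegral

/-! ### Derivatives at the neutral element, with parameters -/

section DerivAtOne

variable {E : Type*} [NormedAddCommGroup E] [NormedSpace ℝ E]
  {G : Type*} [TopologicalSpace G] [ChartedSpace E G] [Group G]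
  {V : Type*} [NormedAddCommGroup V] [NormedSpace ℝ V]

theorem mfderiv_one_eq_fderiv {φ : G → V} (hφ : MDifferentiableAt 𝓘(ℝ, E) 𝓘(ℝ, V) φ 1) (ξ : LieAlg E G) :
    (mfderiv 𝓘(ℝ, E) 𝓘(ℝ, V) φ 1 ξ : V) =
      fderiv ℝ (fun w => φ ((extChartAt 𝓘(ℝ, E) (1 : G)).symm w)) (extChartAt 𝓘(ℝ, E) (1 : G) 1)
        (ξ : E) := by
  refine (congrArg (fun L => L ξ) hφ.mfderiv).trans ?_
  simp only [modelWithCornersSelf_coe, Set.range_id, fderivWithin_univ]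
  rfl

variable [IsManifold 𝓘(ℝ, E) ∞ G]
  {F : Type*} [NormedAddCommGroup F] [NormedSpace ℝ F] {H : Type*} [TopologicalSpace H]
  {J : ModelWithCorners ℝ F H} {N : Type*} [TopologicalSpace N] [ChartedSpace H N]

/-- The base point is always `e`, so one fixed chart turns this into an ordinary partial derivative
of a jointly smooth function. -/
theorem contMDiff_mfderiv_one [IsManifold J ∞ N] {φ : N → G → V}
    (hφ : ContMDiff (J.prod 𝓘(ℝ, E)) 𝓘(ℝ, V) ∞ (Function.uncurry φ)) (ξ : LieAlg E G) :
    ContMDiff J 𝓘(ℝ, V) ∞ fun x => (mfderiv 𝓘(ℝ, E) 𝓘(ℝ, V) (φ x) 1 ξ : V) := by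
  have e : ∀ x, (mfderiv 𝓘(ℝ, E) 𝓘(ℝ, V) (φ x) 1 ξ : V) = _ := fun x =>
    mfderiv_one_eq_fderiv ((hφ.comp (contMDiff_const.prodMk contMDiff_id)
      : ContMDiff 𝓘(ℝ, E) 𝓘(ℝ, V) ∞ fun a => φ x a).mdifferentiableAt (by simp)) ξ
  simp only [e]
  intro x
  refine ContMDiffAt.clm_apply ?_ contMDiffAt_const
  refine contMDiffAt_fderiv (f := fun x w => φ x ((extChartAt 𝓘(ℝ, E) (1 : G)).symm w))
    (g := fun _ => extChartAt 𝓘(ℝ, E) (1 : G) 1) ?_ contMDiffAt_const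
  refine hφ.contMDiffAt.comp (x, extChartAt 𝓘(ℝ, E) (1 : G) 1)
    (f := fun y : N × E => (y.1, (extChartAt 𝓘(ℝ, E) (1 : G)).symm y.2)) ?_
  refine contMDiffAt_fst.prodMk (ContMDiffAt.comp (x, extChartAt 𝓘(ℝ, E) (1 : G) 1)
    (g := (extChartAt 𝓘(ℝ, E) (1 : G)).symm) ?_ contMDiffAt_snd)
  exact (contMDiffOn_extChartAt_symm 1).contMDiffAt
    (extChartAt_target_mem_nhds (I := 𝓘(ℝ, E)) (1 : G))

theorem mfderiv_one_integral [FiniteDimensional ℝ E] [FiniteDimensional ℝ V]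
    {K : Type*} [TopologicalSpace K] [CompactSpace K] [MeasurableSpace K]
    [OpensMeasurableSpace K] (μ : Measure K) [IsFiniteMeasure μ] {ι : K → G} {φ : G → G → V}
    (hφ : ContMDiff (𝓘(ℝ, E).prod 𝓘(ℝ, E)) 𝓘(ℝ, V) ∞ (Function.uncurry φ)) (hι : Continuous ι)
    (ξ : LieAlg E G) :
    (mfderiv 𝓘(ℝ, E) 𝓘(ℝ, V) (fun a => ∫ k, φ a (ι k) ∂μ) 1 ξ : V) =
      ∫ k, (mfderiv 𝓘(ℝ, E) 𝓘(ℝ, V) (fun a => φ a (ι k)) 1 ξ : V) ∂μ := by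
  have e : ∀ k, (mfderiv 𝓘(ℝ, E) 𝓘(ℝ, V) (fun a => φ a (ι k)) 1 ξ : V) = _ := fun k =>
    mfderiv_one_eq_fderiv ((hφ.comp (contMDiff_id.prodMk contMDiff_const)
      : ContMDiff 𝓘(ℝ, E) 𝓘(ℝ, V) ∞ fun a => φ a (ι k)).mdifferentiableAt (by simp)) ξ
  simp only [e]
  refine (mfderiv_one_eq_fderiv ((contMDiff_integral μ hφ hι).mdifferentiableAt (by simp))
    ξ).trans ?_
  have hU : IsOpen (extChartAt 𝓘(ℝ, E) (1 : G)).target := isOpen_extChartAt_target 1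
  have h1 := mem_extChartAt_target (I := 𝓘(ℝ, E)) (1 : G)
  have hF : ContMDiffOn (𝓘(ℝ, E).prod 𝓘(ℝ, E)) (𝓘(ℝ, E).prod 𝓘(ℝ, E)) ∞
      (fun z : E × G => ((extChartAt 𝓘(ℝ, E) (1 : G)).symm z.1, z.2))
      ((extChartAt 𝓘(ℝ, E) (1 : G)).target ×ˢ Set.univ) :=
    ((contMDiffOn_extChartAt_symm 1).comp contMDiffOn_fst fun z hz => hz.1).prodMk contMDiffOn_snd
  have hF' := hφ.comp_contMDiffOn hF
  refine (congrArg (fun L => L (ξ : E))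
    (hasFDerivAt_integral_of_contMDiffOn μ hU hF' hι h1).fderiv).trans ?_
  refine ContinuousLinearMap.integral_apply (integrable_of_continuous μ ?_) _
  refine ContinuousOn.comp_continuous (f := fun k => (extChartAt 𝓘(ℝ, E) (1 : G) 1, ι k))
    (g := fun z : E × G => fderiv ℝ (fun w => φ ((extChartAt 𝓘(ℝ, E) (1 : G)).symm w) z.2) z.1)
    (s := (extChartAt 𝓘(ℝ, E) (1 : G)).target ×ˢ Set.univ) ?_
    (continuous_const.prodMk hι) fun k => ⟨h1, trivial⟩
  exact fun z hz => (contMDiffAt_fderiv_fst (hF'.contMDiffAt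
    ((hU.prod isOpen_univ).mem_nhds hz))).continuousAt.continuousWithinAt

end DerivAtOne

/-! ### Unimodularity of compact groups -/

section HaarMeasure

open Measure

variable {K : Type*} [Group K] [TopologicalSpace K] [IsTopologicalGroup K] [CompactSpace K]
  [MeasurableSpace K] [BorelSpace K] (μ : Measure K) [IsHaarMeasure μ] [IsProbabilityMeasure μ]

/-- Left-invariant measures are proportional, and total mass one fixes the factor. Applied to the
right translates and to the inverse of the Haar measure, this yields both further invariances. -/
theorem eq_haar_of_compactSpace (ν : Measure K) [IsMulLeftInvariant ν] [IsProbabilityMeasure ν] :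
    ν = μ := by
  have h := isMulInvariant_eq_smul_of_compactSpace ν μ
  have h1 : haarScalarFactor ν μ = 1 := by
    have := congrArg (fun m : Measure K => m Set.univ) h
    simp only [measure_univ, Measure.smul_apply] at this
    rw [ENNReal.smul_def, smul_eq_mul, mul_one] at this
    exact_mod_cast this.symm
  rw [h, h1, one_smul]

theorem isMulRightInvariant_of_compactSpace : IsMulRightInvariant μ where
  map_mul_right_eq_self g := by
    have : IsProbabilityMeasure (μ.map fun x => x * g) :=
      Measure.isProbabilityMeasure_map (measurable_mul_const g).aemeasurable
    exact eq_haar_of_compactSpace μ _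

theorem isInvInvariant_of_compactSpace : IsInvInvariant μ where
  inv_eq_self := by
    have := isMulRightInvariant_of_compactSpace μ
    have : IsProbabilityMeasure μ.inv :=
      Measure.isProbabilityMeasure_map measurable_inv.aemeasurable
    exact eq_haar_of_compactSpace μ _

end HaarMeasure

section HaarK

variable {E : Type*} [NormedAddCommGroup E] [NormedSpace ℝ E]
  {G : Type*} [TopologicalSpace G] [ChartedSpace E G] [Group G]
  [LieGroup 𝓘(ℝ, E) ∞ G] [MeasurableSpace G] [BorelSpace G] (K : Subgroup G) [CompactSpace K]
  {V : Type*} [NormedAddCommGroup V] [NormedSpace ℝ V]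

instance isProbabilityMeasure_haarK : IsProbabilityMeasure (haarK E K) where
  measure_univ := by
    have : IsTopologicalGroup G := topologicalGroup_of_lieGroup 𝓘(ℝ, E) ∞
    exact Measure.haarMeasure_self (K₀ := (⊤ : TopologicalSpace.PositiveCompacts K))

theorem integral_haarK_mul_right (f : K → V) (k : K) :
    ∫ x, f (x * k) ∂(haarK E K) = ∫ x, f x ∂(haarK E K) := by
  have : IsTopologicalGroup G := topologicalGroup_of_lieGroup 𝓘(ℝ, E) ∞
  have : (haarK E K).IsHaarMeasure := by unfold haarK; infer_instance
  have := isMulRightInvariant_of_compactSpace (haarK E K)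
  exact integral_mul_right_eq_self f k

theorem integral_haarK_inv (f : K → V) :
    ∫ x, f x⁻¹ ∂(haarK E K) = ∫ x, f x ∂(haarK E K) := by
  have : IsTopologicalGroup G := topologicalGroup_of_lieGroup 𝓘(ℝ, E) ∞
  have : (haarK E K).IsHaarMeasure := by unfold haarK; infer_instance
  have := isInvInvariant_of_compactSpace (haarK E K)
  exact integral_inv_eq_self f _

end HaarK

/-! ### The adjoint derivative for a local group law -/

section LocalGroup

open Filter Topology

variable {E : Type*} [NormedAddCommGroup E] [NormedSpace ℝ E]

/-- If `c (u, w)` is the conjugate of `w` by `u` for a local group law `M` with neutral element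
`w₀`, the derivative at `w₀` of the adjoint action is the commutator of left-invariant fields. -/
theorem fderiv_fderiv_conj {M c : E × E → E} {w₀ : E}
    (hM : ContDiffAt ℝ ∞ M (w₀, w₀)) (hc : ContDiffAt ℝ ∞ c (w₀, w₀))
    (hcw : ∀ᶠ u in 𝓝 w₀, c (u, w₀) = w₀) (hM1 : ∀ᶠ u in 𝓝 w₀, M (u, w₀) = u)
    (hM2 : ∀ᶠ u in 𝓝 w₀, M (w₀, u) = u) (hMc : ∀ᶠ z in 𝓝 (w₀, w₀), M z = M (c z, z.1))
    (ξ η : E) :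
    HasFDerivAt (fun u => fderiv ℝ c (u, w₀) (0, η))
      (fderiv ℝ (fun u => fderiv ℝ c (u, w₀) (0, η)) w₀) w₀ ∧
    fderiv ℝ (fun u => fderiv ℝ c (u, w₀) (0, η)) w₀ ξ =
      fderiv ℝ (fun u => fderiv ℝ M (u, w₀) (0, η)) w₀ ξ
        - fderiv ℝ (fun u => fderiv ℝ M (u, w₀) (0, ξ)) w₀ η := by
  have hinl : ∀ u : E, HasFDerivAt (fun u : E => (u, w₀)) (ContinuousLinearMap.inl ℝ E E) u :=
    fun u => hasFDerivAt_prodMk_left u w₀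
  have hinr : ∀ u : E, HasFDerivAt (fun u : E => (w₀, u)) (ContinuousLinearMap.inr ℝ E E) u :=
    fun u => hasFDerivAt_prodMk_right w₀ u
  have hMd : HasFDerivAt M (fderiv ℝ M (w₀, w₀)) (w₀, w₀) :=
    (hM.differentiableAt (by simp)).hasFDerivAt
  have hD1 : ∀ ζ, fderiv ℝ M (w₀, w₀) (ζ, 0) = ζ := by
    intro ζ
    have h1 := (hMd.comp w₀ (f := fun u : E => (u, w₀)) (hinl w₀)).congr_of_eventuallyEq (hM1.mono fun u hu => hu.symm)
    simpa using congrArg (fun L => L ζ) (h1.unique (hasFDerivAt_id w₀))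
  have hD2 : ∀ ζ, fderiv ℝ M (w₀, w₀) (0, ζ) = ζ := by
    intro ζ
    have h1 := (hMd.comp w₀ (f := fun u : E => (w₀, u)) (hinr w₀)).congr_of_eventuallyEq (hM2.mono fun u hu => hu.symm)
    simpa using congrArg (fun L => L ζ) (h1.unique (hasFDerivAt_id w₀))
  have hfM : HasFDerivAt (fderiv ℝ M) (fderiv ℝ (fderiv ℝ M) (w₀, w₀)) (w₀, w₀) :=
    ((hM.fderiv_right (m := ∞) (by simp)).differentiableAt (by simp)).hasFDerivAt
  have hfc : HasFDerivAt (fderiv ℝ c) (fderiv ℝ (fderiv ℝ c) (w₀, w₀)) (w₀, w₀) :=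
    ((hc.fderiv_right (m := ∞) (by simp)).differentiableAt (by simp)).hasFDerivAt
  have hleft : ∀ ζ, HasFDerivAt (fun u => fderiv ℝ M (u, w₀) (0, ζ)) _ w₀ := fun ζ =>
    (hfM.comp w₀ (f := fun u : E => (u, w₀)) (hinl w₀)).clm_apply (hasFDerivAt_const ((0 : E), ζ) w₀)
  have hA := ((hfc.comp w₀ (f := fun u : E => (u, w₀)) (hinl w₀)).clm_apply
    (hasFDerivAt_const ((0 : E), η) w₀)).differentiableAt.hasFDerivAt
  refine ⟨hA, ?_⟩
  have hnear : Tendsto (fun u : E => (u, w₀)) (𝓝 w₀) (𝓝 (w₀, w₀)) :=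
    (hinl w₀).continuousAt.tendsto
  have hMev : ∀ᶠ z in 𝓝 (w₀, w₀), DifferentiableAt ℝ M z :=
    ((hM.of_le (m := 1) (by simp)).eventually (by simp)).mono fun z hz => hz.differentiableAt (by simp)
  have hcev : ∀ᶠ z in 𝓝 (w₀, w₀), DifferentiableAt ℝ c z :=
    ((hc.of_le (m := 1) (by simp)).eventually (by simp)).mono fun z hz => hz.differentiableAt (by simp)
  -- Differentiate `M (u, w) = M (c (u, w), u)` in `w` at `w₀`, using `c (u, w₀) = w₀`.
  have hid : ∀ᶠ u in 𝓝 w₀, fderiv ℝ M (u, w₀) (0, η) =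
      fderiv ℝ M (w₀, u) (fderiv ℝ c (u, w₀) (0, η), 0) := by
    filter_upwards [hnear.eventually hMc.eventually_nhds, hnear.eventually hcev, hcw,
      (hinr w₀).continuousAt.tendsto.eventually hMev] with u h1 h2 h3 h4
    have e1 : M =ᶠ[𝓝 (u, w₀)] fun z => M (c z, z.1) := h1
    have h4' : HasFDerivAt M (fderiv ℝ M (w₀, u)) (c (u, w₀), (u, w₀).1) := by
      rw [h3]; exact h4.hasFDerivAt
    have h5 := h4'.comp (u, w₀) (h2.hasFDerivAt.prodMk hasFDerivAt_fst)
    rw [e1.fderiv_eq]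
    refine (congrArg (fun L => L ((0 : E), η)) h5.fderiv).trans ?_
    simp
  have hA0 : fderiv ℝ c (w₀, w₀) (0, η) = η := by
    have := hid.self_of_nhds
    rw [hD2, hD1] at this
    exact this.symm
  have hright := (hfM.comp w₀ (f := fun u : E => (w₀, u)) (hinr w₀)).clm_apply (hA.prodMk (hasFDerivAt_const (0 : E) w₀))
  -- Differentiating `hid` in `u` at `w₀` gives the derivative of the adjoint action plus a mixed
  -- second derivative of `M`; symmetry of second derivatives turns the latter into the derivative
  -- of the left-invariant field of `ξ`.
  have key := congrArg (fun L => L ξ)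
    ((hleft η).unique (hright.congr_of_eventuallyEq hid))
  have hsymm := (hM.isSymmSndFDerivAt (by simpa using WithTop.coe_le_coe.2 (le_top (a := (2 : ℕ∞))))) (0, ξ) (η, 0)
  rw [(hleft η).fderiv, (hleft ξ).fderiv, key]
  simp [hA0, hsymm, hD1]

end LocalGroup

/-! ### The adjoint action and the bracket -/

section Adjoint

open Filter Topology VectorField

variable {E : Type*} [NormedAddCommGroup E] [NormedSpace ℝ E]
  {G : Type*} [TopologicalSpace G] [ChartedSpace E G] [Group G]

variable (E G) in
/-- The chart of `G` at the neutral element. -/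
abbrev chartOne : PartialEquiv G E := extChartAt 𝓘(ℝ, E) (1 : G)

variable (E G) in
/-- The multiplication of `G` in the chart at the neutral element. -/
def coordMul (z : E × E) : E :=
  chartOne E G ((chartOne E G).symm z.1 * (chartOne E G).symm z.2)

variable (E G) in
/-- The conjugation of `G` in the chart at the neutral element. -/
def coordConj (z : E × E) : E :=
  chartOne E G ((chartOne E G).symm z.1 * (chartOne E G).symm z.2 * ((chartOne E G).symm z.1)⁻¹)

@[simp] theorem chartOne_symm_chartOne_one :
    (chartOne E G).symm (chartOne E G 1) = 1 :=
  extChartAt_to_inv (I := 𝓘(ℝ, E)) (1 : G)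

theorem mfderiv_one_eq_fderiv_chartOne {φ : G → G}
    (hφ : MDifferentiableAt 𝓘(ℝ, E) 𝓘(ℝ, E) φ 1) (h1 : φ 1 = 1) (ξ : LieAlg E G) :
    (mfderiv 𝓘(ℝ, E) 𝓘(ℝ, E) φ 1 ξ : E) =
      fderiv ℝ (fun w => chartOne E G (φ ((chartOne E G).symm w))) (chartOne E G 1) (ξ : E) := by
  refine (congrArg (fun L => L ξ) hφ.mfderiv).trans ?_
  simp only [modelWithCornersSelf_coe, Set.range_id, fderivWithin_univ]
  unfold writtenInExtChartAt
  rw [h1]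
  rfl

variable [LieGroup 𝓘(ℝ, E) ∞ G]

theorem contDiffAt_chartOne {f : G × G → G}
    (hf : ContMDiff (𝓘(ℝ, E).prod 𝓘(ℝ, E)) 𝓘(ℝ, E) ∞ f) (h1 : f (1, 1) = 1) :
    ContDiffAt ℝ ∞ (fun z : E × E =>
      chartOne E G (f ((chartOne E G).symm z.1, (chartOne E G).symm z.2)))
      (chartOne E G 1, chartOne E G 1) := by
  have hs : ContMDiffAt 𝓘(ℝ, E) 𝓘(ℝ, E) ∞ (chartOne E G).symm (chartOne E G 1) :=
    (contMDiffOn_extChartAt_symm 1).contMDiffAt (extChartAt_target_mem_nhds (I := 𝓘(ℝ, E)) (1 : G))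
  have hp : ContMDiffAt 𝓘(ℝ, E × E) (𝓘(ℝ, E).prod 𝓘(ℝ, E)) ∞
      (fun z : E × E => ((chartOne E G).symm z.1, (chartOne E G).symm z.2))
      (chartOne E G 1, chartOne E G 1) :=
    (hs.comp (chartOne E G 1, chartOne E G 1) contDiffAt_fst.contMDiffAt).prodMk
      (hs.comp (chartOne E G 1, chartOne E G 1) contDiffAt_snd.contMDiffAt)
  have hc : ContMDiffAt 𝓘(ℝ, E) 𝓘(ℝ, E) ∞ (chartOne E G)
      (f ((chartOne E G).symm (chartOne E G 1), (chartOne E G).symm (chartOne E G 1))) := by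
    rw [chartOne_symm_chartOne_one, h1]
    exact contMDiffAt_extChartAt
  exact (ContMDiffAt.comp (chartOne E G 1, chartOne E G 1) hc
    (hf.contMDiffAt.comp (chartOne E G 1, chartOne E G 1) hp)).contDiffAt

theorem contDiffAt_coordMul :
    ContDiffAt ℝ ∞ (coordMul E G) (chartOne E G 1, chartOne E G 1) :=
  contDiffAt_chartOne (f := fun z : G × G => z.1 * z.2) (contMDiff_mul 𝓘(ℝ, E) ∞) (by simp)

theorem contMDiff_conj : ContMDiff (𝓘(ℝ, E).prod 𝓘(ℝ, E)) 𝓘(ℝ, E) ∞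
    fun z : G × G => z.1 * z.2 * z.1⁻¹ :=
  (contMDiff_mul 𝓘(ℝ, E) ∞).mul contMDiff_fst.inv

theorem contMDiff_conj_right (a : G) : ContMDiff 𝓘(ℝ, E) 𝓘(ℝ, E) ∞ fun x : G => a * x * a⁻¹ :=
  (contMDiff_const.mul contMDiff_id).mul contMDiff_const

theorem contDiffAt_coordConj :
    ContDiffAt ℝ ∞ (coordConj E G) (chartOne E G 1, chartOne E G 1) :=
  contDiffAt_chartOne (f := fun z : G × G => z.1 * z.2 * z.1⁻¹) contMDiff_conj (by simp)

omit [LieGroup 𝓘(ℝ, E) ∞ G] in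
theorem tendsto_mk_chartOne :
    Tendsto (fun u : E => (u, chartOne E G 1)) (𝓝 (chartOne E G 1))
      (𝓝 (chartOne E G 1, chartOne E G 1)) :=
  (Continuous.prodMk_left (chartOne E G 1)).tendsto' _ _ rfl

theorem fderiv_snd_eq {f : E × E → E} {u w : E} (hf : DifferentiableAt ℝ f (u, w)) (η : E) :
    fderiv ℝ (fun x => f (u, x)) w η = fderiv ℝ f (u, w) (0, η) := by
  have h := (hf.hasFDerivAt.comp w (f := fun x : E => (u, x)) (hasFDerivAt_prodMk_right u w)).fderiv
  refine (congrArg (fun L => L η) h).trans ?_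
  simp

theorem eventually_Ad_eq (η : LieAlg E G) :
    ∀ᶠ u in 𝓝 (chartOne E G 1), (Ad E ((chartOne E G).symm u) η : E) =
      fderiv ℝ (coordConj E G) (u, chartOne E G 1) (0, (η : E)) := by
  have h : ∀ᶠ z in 𝓝 (chartOne E G 1, chartOne E G 1), DifferentiableAt ℝ (coordConj E G) z :=
    ((contDiffAt_coordConj.of_le (m := 1) (by simp)).eventually (by simp)).mono
      fun z hz => hz.differentiableAt (by simp)
  filter_upwards [tendsto_mk_chartOne.eventually h] with u hu
  refine Eq.trans ?_ (fderiv_snd_eq hu (η : E))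
  exact mfderiv_one_eq_fderiv_chartOne ((contMDiff_conj_right _).mdifferentiableAt (by simp))
    (by simp) η

/-- The left-invariant field at `g` is the derivative of `x ↦ g x` at `e`. Pulling back along the
inverse chart is pushing forward by the chart, so the chain rule gives a partial derivative of the
multiplication in coordinates. -/
theorem eventually_mpullbackWithin_eq (η : LieAlg E G) :
    ∀ᶠ u in 𝓝 (chartOne E G 1),
      mpullbackWithin 𝓘(ℝ, E) 𝓘(ℝ, E) (chartOne E G).symm (mulInvariantVectorField η)
        (Set.range 𝓘(ℝ, E)) u =
      fderiv ℝ (coordMul E G) (u, chartOne E G 1) (0, (η : E)) := by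
  have : IsManifold 𝓘(ℝ, E) 1 G := IsManifold.of_le (n := ∞) (by simp)
  have h : ∀ᶠ z in 𝓝 (chartOne E G 1, chartOne E G 1), DifferentiableAt ℝ (coordMul E G) z :=
    ((contDiffAt_coordMul.of_le (m := 1) (by simp)).eventually (by simp)).mono
      fun z hz => hz.differentiableAt (by simp)
  filter_upwards [tendsto_mk_chartOne.eventually h,
    extChartAt_target_mem_nhds (I := 𝓘(ℝ, E)) (1 : G)] with u hu hut
  refine Eq.trans ?_ (fderiv_snd_eq hu (η : E))
  have hus : (chartOne E G).symm u ∈ (chartAt E (1 : G)).source := by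
    simpa using (chartOne E G).map_target hut
  have hinv : (mfderivWithin 𝓘(ℝ, E) 𝓘(ℝ, E) (chartOne E G).symm (Set.range 𝓘(ℝ, E)) u).inverse =
      mfderiv 𝓘(ℝ, E) 𝓘(ℝ, E) (chartOne E G) ((chartOne E G).symm u) :=
    ContinuousLinearMap.inverse_eq
      (mfderivWithin_extChartAt_symm_comp_mfderiv_extChartAt hut)
      (mfderiv_extChartAt_comp_mfderivWithin_extChartAt_symm hut)
  rw [mpullbackWithin_apply, hinv]
  have hmul : MDifferentiableAt 𝓘(ℝ, E) 𝓘(ℝ, E)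
      (fun x : G => (chartOne E G).symm u * x) 1 :=
    (contMDiff_mul_left (I := 𝓘(ℝ, E)) (n := ∞)).mdifferentiableAt (by simp)
  have hch : MDifferentiableAt 𝓘(ℝ, E) 𝓘(ℝ, E) (chartOne E G)
      ((fun x : G => (chartOne E G).symm u * x) 1) := by
    simp only [mul_one]
    exact mdifferentiableAt_extChartAt hus
  have e1 := mfderiv_one_eq_fderiv (hch.comp (1 : G) hmul) η
  refine Eq.trans ?_ e1
  have e2 := congrArg (fun L => L η) (mfderiv_comp (1 : G) hch hmul)
  refine Eq.trans ?_ e2.symm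
  have e3 : ∀ (g g' : G), g' = g → ∀ v : E, (mfderiv 𝓘(ℝ, E) 𝓘(ℝ, E) (chartOne E G) g v : E) =
      mfderiv 𝓘(ℝ, E) 𝓘(ℝ, E) (chartOne E G) g' v := by
    rintro g _ rfl v
    rfl
  exact e3 _ _ (mul_one _) _

/-- In the chart at `e` the bracket of fields is `DY(X) - DX(Y)`, and at `e` each left-invariant
field takes the value that defines it. -/
theorem bracket_eq_fderiv_coordMul (ξ η : LieAlg E G) :
    (⁅ξ, η⁆ : LieAlg E G) =
      (fderiv ℝ (fun u => fderiv ℝ (coordMul E G) (u, chartOne E G 1) (0, (η : E)))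
          (chartOne E G 1) (ξ : E)
        - fderiv ℝ (fun u => fderiv ℝ (coordMul E G) (u, chartOne E G 1) (0, (ξ : E)))
          (chartOne E G 1) (η : E) : E) := by
  have : IsManifold 𝓘(ℝ, E) 1 G := IsManifold.of_le (n := ∞) (by simp)
  have hD : ∀ ζ : E, fderiv ℝ (coordMul E G) (chartOne E G 1, chartOne E G 1) (0, ζ) = ζ := by
    intro ζ
    have h := contDiffAt_coordMul (E := E) (G := G)
    rw [← fderiv_snd_eq (h.differentiableAt (by simp))]
    have e : (fun x => coordMul E G (chartOne E G 1, x)) =ᶠ[𝓝 (chartOne E G 1)] id := by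
      filter_upwards [extChartAt_target_mem_nhds (I := 𝓘(ℝ, E)) (1 : G)] with u hu
      simp only [coordMul, chartOne_symm_chartOne_one, one_mul, id]
      exact (chartOne E G).right_inv hu
    rw [e.fderiv_eq]
    simp
  rw [GroupLieAlgebra.bracket_def, ← mlieBracketWithin_univ, mlieBracketWithin_apply,
    mfderiv_extChartAt_self]
  refine (congrArg (fun L : E →L[ℝ] E => L _)
    (ContinuousLinearMap.inverse_id (R := ℝ) (M := E))).trans ?_
  have e : (chartOne E G).symm ⁻¹' Set.univ ∩ Set.range 𝓘(ℝ, E) = Set.univ := by simp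
  refine (congrArg (fun s => lieBracketWithin ℝ _ _ s (chartOne E G 1)) e).trans ?_
  refine (congrFun lieBracketWithin_univ (chartOne E G 1)).trans ?_
  refine (Filter.EventuallyEq.lieBracket_vectorField_eq (eventually_mpullbackWithin_eq ξ)
    (eventually_mpullbackWithin_eq η)).trans ?_
  exact congrArg₂ (fun x y : E => x - y) (congrArg _ (hD _)) (congrArg _ (hD _))

omit [LieGroup 𝓘(ℝ, E) ∞ G] in
theorem hasDerivAt_chartOne_curve {γ : ℝ → G} (hγ : MDifferentiableAt 𝓘(ℝ, ℝ) 𝓘(ℝ, E) γ 0)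
    (h1 : γ 0 = 1) :
    HasDerivAt (fun t => chartOne E G (γ t))
      (mfderiv 𝓘(ℝ, ℝ) 𝓘(ℝ, E) γ 0 (1 : ℝ) : E) 0 := by
  have hd := ((mdifferentiableAt_iff _ _).1 hγ).2
  have e : writtenInExtChartAt 𝓘(ℝ, ℝ) 𝓘(ℝ, E) 0 γ = fun t => chartOne E G (γ t) := by
    unfold writtenInExtChartAt
    rw [h1]
    rfl
  have e2 : (mfderiv 𝓘(ℝ, ℝ) 𝓘(ℝ, E) γ 0 (1 : ℝ) : E) =
      fderiv ℝ (writtenInExtChartAt 𝓘(ℝ, ℝ) 𝓘(ℝ, E) 0 γ) 0 1 := by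
    refine (congrArg (fun L => L (1 : ℝ)) hγ.mfderiv).trans ?_
    simp only [modelWithCornersSelf_coe, Set.range_id, fderivWithin_univ]
    rfl
  rw [e] at hd e2
  rw [e2]
  simp only [modelWithCornersSelf_coe, Set.range_id, differentiableWithinAt_univ] at hd
  exact (show DifferentiableAt ℝ (fun t => chartOne E G (γ t)) 0 from hd).hasFDerivAt.hasDerivAt

/-- In the chart, `Ad` is a partial derivative of conjugation; `fderiv_fderiv_conj` differentiates
it at `e`, and the chain rule transports this to any curve with velocity `ξ`. -/
theorem hasDerivAt_Ad {γ : ℝ → G} (hγ : MDifferentiableAt 𝓘(ℝ, ℝ) 𝓘(ℝ, E) γ 0) (h1 : γ 0 = 1)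
    {ξ : LieAlg E G} (hξ : (mfderiv 𝓘(ℝ, ℝ) 𝓘(ℝ, E) γ 0 (1 : ℝ) : E) = ξ) (η : LieAlg E G) :
    HasDerivAt (F := E) (fun t => Ad E (γ t) η) (⁅ξ, η⁆ : LieAlg E G) 0 := by
  have hφ := hasDerivAt_chartOne_curve hγ h1
  rw [hξ] at hφ
  have hs : ∀ᶠ u in 𝓝 (chartOne E G 1), u ∈ (chartOne E G).target :=
    extChartAt_target_mem_nhds (I := 𝓘(ℝ, E)) (1 : G)
  have hsymm : ContinuousAt (chartOne E G).symm (chartOne E G 1) :=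
    continuousAt_extChartAt_symm (I := 𝓘(ℝ, E)) (1 : G)
  have hconj : ∀ᶠ z in 𝓝 (chartOne E G 1, chartOne E G 1),
      (chartOne E G).symm z.1 * (chartOne E G).symm z.2 * ((chartOne E G).symm z.1)⁻¹ ∈
        (chartOne E G).source := by
    have hc : ContinuousAt (fun z : E × E => ((chartOne E G).symm z.1, (chartOne E G).symm z.2))
        (chartOne E G 1, chartOne E G 1) :=
      (ContinuousAt.comp (x := (chartOne E G 1, chartOne E G 1)) hsymm continuousAt_fst).prodMk
        (ContinuousAt.comp (x := (chartOne E G 1, chartOne E G 1)) hsymm continuousAt_snd)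
    have hcc := (contMDiff_conj (E := E) (G := G)).continuous.continuousAt.comp hc
    refine hcc.preimage_mem_nhds ?_
    simp only [Function.comp_apply, chartOne_symm_chartOne_one, mul_one, inv_one]
    exact extChartAt_source_mem_nhds (I := 𝓘(ℝ, E)) (1 : G)
  have hM1 : ∀ᶠ u in 𝓝 (chartOne E G 1), coordMul E G (u, chartOne E G 1) = u := by
    filter_upwards [hs] with u hu
    simp only [coordMul, chartOne_symm_chartOne_one, mul_one]
    exact (chartOne E G).right_inv hu
  have hM2 : ∀ᶠ u in 𝓝 (chartOne E G 1), coordMul E G (chartOne E G 1, u) = u := by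
    filter_upwards [hs] with u hu
    simp only [coordMul, chartOne_symm_chartOne_one, one_mul]
    exact (chartOne E G).right_inv hu
  have hMc : ∀ᶠ z in 𝓝 (chartOne E G 1, chartOne E G 1),
      coordMul E G z = coordMul E G (coordConj E G z, z.1) := by
    filter_upwards [hconj] with z hz
    simp only [coordMul, coordConj, (chartOne E G).left_inv hz, inv_mul_cancel_right]
  obtain ⟨hA, hAe⟩ := fderiv_fderiv_conj (M := coordMul E G) (c := coordConj E G)
    contDiffAt_coordMul contDiffAt_coordConj (.of_forall fun u => by simp [coordConj]) hM1 hM2 hMc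
    (ξ : E) (η : E)
  have hφ0 : chartOne E G (γ 0) = chartOne E G 1 := by rw [h1]
  have h := HasFDerivAt.comp_hasDerivAt_of_eq (0 : ℝ) hA hφ hφ0.symm
  have hb := bracket_eq_fderiv_coordMul ξ η
  rw [hb, ← hAe]
  refine h.congr_of_eventuallyEq ?_
  have hγ0 : Tendsto γ (𝓝 0) (𝓝 1) := by
    have := hγ.continuousAt.tendsto
    rwa [h1] at this
  have hφγ : Tendsto (fun t => chartOne E G (γ t)) (𝓝 0) (𝓝 (chartOne E G 1)) :=
    ((continuousAt_extChartAt (I := 𝓘(ℝ, E)) (1 : G)).tendsto).comp hγ0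
  filter_upwards [hγ0.eventually (extChartAt_source_mem_nhds (I := 𝓘(ℝ, E)) (1 : G)),
    hφγ.eventually (eventually_Ad_eq η)] with t h1 h2
  rw [(chartOne E G).left_inv h1] at h2
  exact h2

omit [LieGroup 𝓘(ℝ, E) ∞ G] in
theorem Ad_add (a : G) (ξ η : LieAlg E G) : Ad E a (ξ + η) = Ad E a ξ + Ad E a η :=
  map_add (mfderiv 𝓘(ℝ, E) 𝓘(ℝ, E) (fun x : G => a * x * a⁻¹) 1) ξ η

omit [LieGroup 𝓘(ℝ, E) ∞ G] in
theorem Ad_smul (a : G) (c : ℝ) (ξ : LieAlg E G) : Ad E a (c • ξ) = c • Ad E a ξ :=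
  map_smul (mfderiv 𝓘(ℝ, E) 𝓘(ℝ, E) (fun x : G => a * x * a⁻¹) 1) c ξ

/-- The adjoint action as a linear map. -/
@[simps]
def AdLin (a : G) : LieAlg E G →ₗ[ℝ] LieAlg E G where
  toFun := Ad E a
  map_add' := Ad_add a
  map_smul' := Ad_smul a

section Comp

variable {F : Type*} [NormedAddCommGroup F] [NormedSpace ℝ F] {H : Type*} [TopologicalSpace H]
  {J : ModelWithCorners ℝ F H} {N : Type*} [TopologicalSpace N] [ChartedSpace H N]

omit [Group G] [LieGroup 𝓘(ℝ, E) ∞ G] in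
-- All tangent spaces are `E` by definition, so derivatives at propositionally equal points can be
-- compared without a cast.
theorem mfderiv_congr_point {f : G → N} {g g' : G} (h : g = g') (v : E) :
    (mfderiv 𝓘(ℝ, E) J f g v : F) = mfderiv 𝓘(ℝ, E) J f g' v := by
  subst h
  rfl

theorem mfderiv_comp_conj {f : G → N} (hf : MDifferentiableAt 𝓘(ℝ, E) J f 1) (a : G)
    (ξ : LieAlg E G) :
    (mfderiv 𝓘(ℝ, E) J (fun x => f (a * x * a⁻¹)) 1 ξ : F) =
      mfderiv 𝓘(ℝ, E) J f 1 (Ad E a ξ : E) := by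
  have hc : MDifferentiableAt 𝓘(ℝ, E) 𝓘(ℝ, E) (fun x : G => a * x * a⁻¹) 1 :=
    (contMDiff_conj_right a).mdifferentiableAt (by simp)
  have h1 : (fun x : G => a * x * a⁻¹) 1 = 1 := by simp
  have e := congrArg (fun L => L ξ) (mfderiv_comp (1 : G) (h1 ▸ hf) hc)
  exact e.trans (mfderiv_congr_point h1 _)

end Comp

theorem Ad_mul (a b : G) (ξ : LieAlg E G) : Ad E (a * b) ξ = Ad E a (Ad E b ξ) := by
  have e : (fun x => a * b * x * (a * b)⁻¹) = fun x => a * (b * x * b⁻¹) * a⁻¹ := by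
    funext x
    group
  exact (congrArg (fun f : G → G => (mfderiv 𝓘(ℝ, E) 𝓘(ℝ, E) f 1 ξ : E)) e).trans
    (mfderiv_comp_conj ((contMDiff_conj_right a).mdifferentiableAt (by simp)) b ξ)

omit [LieGroup 𝓘(ℝ, E) ∞ G] in
theorem Ad_one (ξ : LieAlg E G) : Ad E (1 : G) ξ = ξ := by
  have e : (fun x : G => 1 * x * 1⁻¹) = id := by
    funext x
    simp
  exact (congrArg (fun f : G → G => (mfderiv 𝓘(ℝ, E) 𝓘(ℝ, E) f 1 ξ : E)) e).trans
    (congrArg (fun L => L ξ) mfderiv_id)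

theorem Ad_inv_Ad (a : G) (ξ : LieAlg E G) : Ad E a⁻¹ (Ad E a ξ) = ξ := by
  rw [← Ad_mul, inv_mul_cancel, Ad_one]

theorem exists_curve (ξ : LieAlg E G) : ∃ γ : ℝ → G, MDifferentiableAt 𝓘(ℝ, ℝ) 𝓘(ℝ, E) γ 0 ∧
    γ 0 = 1 ∧ (mfderiv 𝓘(ℝ, ℝ) 𝓘(ℝ, E) γ 0 (1 : ℝ) : E) = ξ := by
  let v : E := ξ
  let l : ℝ → E := fun t => chartOne E G 1 + t • v
  have hl : HasDerivAt l v 0 :=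
    (((hasDerivAt_id (0 : ℝ)).smul_const v).const_add (chartOne E G 1)).congr_deriv (one_smul ℝ v)
  have hl0 : l 0 = chartOne E G 1 := by simp [l]
  have hs : MDifferentiableAt 𝓘(ℝ, E) 𝓘(ℝ, E) (chartOne E G).symm (l 0) := by
    rw [hl0]
    exact ((contMDiffOn_extChartAt_symm (n := ∞) 1).contMDiffAt
      (extChartAt_target_mem_nhds (I := 𝓘(ℝ, E)) (1 : G))).mdifferentiableAt (by simp)
  have hγ : MDifferentiableAt 𝓘(ℝ, ℝ) 𝓘(ℝ, E) (fun t => (chartOne E G).symm (l t)) 0 :=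
    hs.comp (0 : ℝ) hl.differentiableAt.mdifferentiableAt
  have h1 : (chartOne E G).symm (l 0) = 1 := by rw [hl0, chartOne_symm_chartOne_one]
  refine ⟨_, hγ, h1, (hasDerivAt_chartOne_curve hγ h1).unique (hl.congr_of_eventuallyEq ?_)⟩
  have ht : Tendsto l (𝓝 0) (𝓝 (chartOne E G 1)) := by
    have := hl.continuousAt.tendsto
    rwa [hl0] at this
  filter_upwards [ht.eventually (extChartAt_target_mem_nhds (I := 𝓘(ℝ, E)) (1 : G))] with t ht
  exact (chartOne E G).right_inv ht

/-- Differentiate `Ad a (Ad (γ t) η) = Ad (a γ(t) a⁻¹) (Ad a η)` at `t = 0` along a curve with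
velocity `ξ`. -/
theorem Ad_bracket [FiniteDimensional ℝ E] (a : G) (ξ η : LieAlg E G) :
    Ad E a ⁅ξ, η⁆ = ⁅Ad E a ξ, Ad E a η⁆ := by
  obtain ⟨γ, hγ, h1, hξ⟩ := exists_curve ξ
  have hc : MDifferentiableAt 𝓘(ℝ, E) 𝓘(ℝ, E) (fun x : G => a * x * a⁻¹) (γ 0) :=
    (contMDiff_conj_right a).mdifferentiableAt (by simp)
  have hγ' := hc.comp (0 : ℝ) hγ
  have hξ' : (mfderiv 𝓘(ℝ, ℝ) 𝓘(ℝ, E) ((fun x : G => a * x * a⁻¹) ∘ γ) 0 (1 : ℝ) : E) =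
      Ad E a ξ := by
    have e := congrArg (fun L => L (1 : ℝ)) (mfderiv_comp (0 : ℝ) hc hγ)
    refine e.trans ((mfderiv_congr_point h1 _).trans ?_)
    exact congrArg (fun v : E => (mfderiv 𝓘(ℝ, E) 𝓘(ℝ, E) (fun x : G => a * x * a⁻¹) 1 v : E)) hξ
  have h2 := hasDerivAt_Ad hγ' (by simp [h1]) hξ' (Ad E a η)
  have h3 := hasDerivAt_Ad hγ h1 hξ η
  let L : E →L[ℝ] E := LinearMap.toContinuousLinearMap (show E →ₗ[ℝ] E from AdLin (E := E) a)
  have h4 := L.hasFDerivAt.comp_hasDerivAt (0 : ℝ) h3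
  refine h4.unique (h2.congr_of_eventuallyEq (.of_forall fun t => ?_))
  have e : Ad E a (Ad E (γ t) η) = Ad E (a * γ t * a⁻¹) (Ad E a η) := by
    rw [Ad_mul, Ad_inv_Ad, Ad_mul]
  exact e

end Adjoint

/-! ### Alternating cochains -/

section Forms

variable {E : Type*} [NormedAddCommGroup E] [NormedSpace ℝ E] [FiniteDimensional ℝ E]
  {G : Type*} [TopologicalSpace G] [ChartedSpace E G] [Group G] [LieGroup 𝓘(ℝ, E) ∞ G]
  {V : Type*} [NormedAddCommGroup V] [NormedSpace ℝ V]

variable (E G) in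
omit [FiniteDimensional ℝ E] in
theorem lieGroup_minSmoothness : LieGroup 𝓘(ℝ, E) (minSmoothness ℝ 3) G :=
  LieGroup.of_le (n := ∞) (by simpa using WithTop.coe_le_coe.2 (le_top (a := (3 : ℕ∞))))

variable (E G) in
/-- The bracket of `𝔤` as a bilinear map. -/
def bracketLin : LieAlg E G →ₗ[ℝ] LieAlg E G →ₗ[ℝ] LieAlg E G :=
  haveI := lieGroup_minSmoothness E G
  haveI := FiniteDimensional.complete ℝ E
  LinearMap.mk₂ ℝ (fun ξ η => ⁅ξ, η⁆) add_lie smul_lie lie_add lie_smul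

@[simp] theorem bracketLin_apply (ξ η : LieAlg E G) : bracketLin E G ξ η = ⁅ξ, η⁆ := rfl

theorem neg_bracket (ξ η : LieAlg E G) : -⁅ξ, η⁆ = ⁅η, ξ⁆ := by
  have := lieGroup_minSmoothness E G
  have := FiniteDimensional.complete ℝ E
  exact lie_skew η ξ

/-- The double alternatization counts each pair of arguments in both orders, and antisymmetry of the
bracket makes the two contributions equal: hence the factor one half, the minus sign being one of
convention. Alternation of the bracket term then needs no computation. -/
theorem bracketTerm_eq_alternatizeUncurryFin {q : ℕ} (β : LieAlg E G [⋀^Fin (q + 1)]→ₗ[ℝ] V)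
    (ξ : Fin (q + 2) → LieAlg E G) :
    bracketTerm (fun ζ => β ζ) ξ = (-(1 / 2) : ℝ) •
      AlternatingMap.alternatizeUncurryFin (AlternatingMap.alternatizeUncurryFinLM ∘ₗ
        (bracketLin E G).compr₂ β.curryLeft) ξ := by
  rw [AlternatingMap.alternatizeUncurryFin_alternatizeUncurryFinLM_comp_apply]
  simp only [bracketTerm]
  rw [Finset.sum_comm, Finset.smul_sum]
  refine Finset.sum_congr rfl fun i _ => ?_
  -- Pairs of positions `a < b` are parametrized by `a = i.castSucc`, `b = j.succ` with `i ≤ j`; the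
  -- remaining terms vanish.
  rw [Fin.sum_univ_succ, Finset.smul_sum, ← Finset.sum_subset (Finset.subset_univ (Finset.Ici i))]
  · rw [if_neg (Fin.not_lt_zero _), zero_add]
    refine Finset.sum_congr rfl fun j hj => ?_
    have hij := Finset.mem_Ici.1 hj
    have hlt : i.castSucc < j.succ := Fin.castSucc_lt_succ_iff.2 hij
    rw [if_pos hlt]
    have hrem : j.removeNth (i.castSucc.removeNth ξ) = i.removeNth (j.succ.removeNth ξ) := by
      symm
      rw [Fin.removeNth_removeNth_eq_swap]
      simp [Fin.predAbove, hij, Fin.succAbove]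
    have h1 : (bracketLin E G).compr₂ β.curryLeft (ξ j.succ) (ξ i.castSucc) =
        -((bracketLin E G).compr₂ β.curryLeft (ξ i.castSucc) (ξ j.succ)) := by
      rw [LinearMap.compr₂_apply, LinearMap.compr₂_apply, bracketLin_apply, bracketLin_apply,
        ← neg_bracket (ξ i.castSucc) (ξ j.succ), LinearMap.map_neg]
    rw [h1, hrem]
    have h2 : ((bracketLin E G).compr₂ β.curryLeft (ξ i.castSucc) (ξ j.succ))
        (i.removeNth (j.succ.removeNth ξ)) =
          β (Fin.cons ⁅ξ i.castSucc, ξ j.succ⁆ (i.removeNth (j.succ.removeNth ξ))) := rfl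
    rw [AlternatingMap.neg_apply, h2, ← Int.cast_smul_eq_zsmul ℝ, sub_neg_eq_add, ← two_smul ℝ,
      smul_smul, smul_smul]
    congr 1
    push_cast
    rw [Fin.val_succ]
    ring
  · intro j _ hj
    rw [Finset.mem_Ici, not_le] at hj
    rw [if_neg]
    simp only [Fin.lt_def, Fin.val_castSucc, Fin.val_succ, not_lt] at *
    omega

theorem isForm_bracketTerm {q : ℕ} {α : Cochain E G V q} (hα : IsForm α) :
    IsForm (bracketTerm α) := by
  obtain ⟨β, hβ⟩ := hα
  obtain rfl : α = fun ζ => β ζ := funext hβ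
  cases q with
  | zero => exact ⟨0, fun ξ => rfl⟩
  | succ q =>
    exact ⟨(-(1 / 2) : ℝ) • AlternatingMap.alternatizeUncurryFin
      (AlternatingMap.alternatizeUncurryFinLM ∘ₗ (bracketLin E G).compr₂ β.curryLeft),
      bracketTerm_eq_alternatizeUncurryFin β⟩

omit [FiniteDimensional ℝ E] [LieGroup 𝓘(ℝ, E) ∞ G] in
theorem IsForm.add {q : ℕ} {α β : Cochain E G V q} (hα : IsForm α) (hβ : IsForm β) :
    IsForm (α + β) := by
  obtain ⟨a, ha⟩ := hα
  obtain ⟨b, hb⟩ := hβ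
  exact ⟨a + b, fun ξ => congrArg₂ (· + ·) (ha ξ) (hb ξ)⟩

omit [FiniteDimensional ℝ E] [LieGroup 𝓘(ℝ, E) ∞ G] in
theorem IsForm.smul {q : ℕ} {α : Cochain E G V q} (c : ℝ) (hα : IsForm α) :
    IsForm (c • α) := by
  obtain ⟨a, ha⟩ := hα
  exact ⟨c • a, fun ξ => congrArg (c • ·) (ha ξ)⟩

omit [FiniteDimensional ℝ E] [LieGroup 𝓘(ℝ, E) ∞ G] in
theorem IsForm.zero {q : ℕ} : IsForm (0 : Cochain E G V q) := ⟨0, fun _ => rfl⟩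

omit [FiniteDimensional ℝ E] [LieGroup 𝓘(ℝ, E) ∞ G] in
/-- A family of alternating maps, differentiated in the direction of a further argument and
alternated, is alternating. -/
theorem isForm_sum_mfderiv {q : ℕ} {η : G → Cochain E G V q} (hη : ∀ a, IsForm (η a))
    (hd : ∀ w, MDifferentiableAt 𝓘(ℝ, E) 𝓘(ℝ, V) (fun a => η a w) 1) :
    IsForm (q := q + 1) (E := E) (G := G) (V := V)
      fun ξ => ∑ i : Fin (q + 1), (-1 : ℝ) ^ i.val •
        (mfderiv 𝓘(ℝ, E) 𝓘(ℝ, V) (fun a => η a (i.removeNth ξ)) 1 (ξ i) : V) := by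
  choose β hβ using hη
  let D : LieAlg E G → (Fin q → LieAlg E G) → V := fun ζ w =>
    mfderiv 𝓘(ℝ, E) 𝓘(ℝ, V) (fun a => η a w) 1 ζ
  have hD1 : ∀ ζ ζ' w, D (ζ + ζ') w = D ζ w + D ζ' w := fun ζ ζ' w => map_add _ _ _
  have hD2 : ∀ (c : ℝ) ζ w, D (c • ζ) w = c • D ζ w := fun c ζ w => map_smul _ _ _
  -- A two-term linear relation valid for every `a` survives differentiation. Additivity,
  -- homogeneity (`c' = 0`) and vanishing on repeated arguments (`c = c' = 0`) are all instances.
  have key : ∀ (ζ : LieAlg E G) {w w' w'' : Fin q → LieAlg E G} (c c' : ℝ),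
      (∀ a, η a w = c • η a w' + c' • η a w'') → D ζ w = c • D ζ w' + c' • D ζ w'' := by
    intro ζ w w' w'' c c' h
    have h1 := ((hd w').hasMFDerivAt.const_smul c).add ((hd w'').hasMFDerivAt.const_smul c')
    have e : (fun a => η a w) = (c • fun a => η a w') + (c' • fun a => η a w'') := funext h
    exact congrArg (fun L => L ζ) ((h1.congr_of_eventuallyEq (.of_eq e)).mfderiv)
  let T : LieAlg E G →ₗ[ℝ] LieAlg E G [⋀^Fin q]→ₗ[ℝ] V :=
    { toFun := fun ζ =>
        { toFun := D ζ
          map_update_add' := fun w l x y => by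
            have := key ζ (w := Function.update w l (x + y)) (w' := Function.update w l x)
              (w'' := Function.update w l y) 1 1 fun a => by
              rw [hβ, hβ, hβ, AlternatingMap.map_update_add, one_smul, one_smul]
            rw [one_smul, one_smul] at this
            convert this
          map_update_smul' := fun w l c x => by
            have := key ζ (w := Function.update w l (c • x)) (w' := Function.update w l x)
              (w'' := w) c 0 fun a => by
              rw [hβ, hβ, AlternatingMap.map_update_smul, zero_smul, add_zero]
            rw [zero_smul, add_zero] at this
            convert this
          map_eq_zero_of_eq' := fun w l l' h hl => by
            have := key ζ (w := w) (w' := w) (w'' := w) 0 0 fun a => by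
              rw [hβ, (β a).map_eq_zero_of_eq w h hl, smul_zero, add_zero]
            rwa [zero_smul, add_zero] at this }
      map_add' := fun ζ ζ' => AlternatingMap.ext fun w => hD1 ζ ζ' w
      map_smul' := fun c ζ => AlternatingMap.ext fun w => hD2 c ζ w }
  refine ⟨AlternatingMap.alternatizeUncurryFin T, fun ξ => ?_⟩
  rw [AlternatingMap.alternatizeUncurryFin_apply]
  refine Finset.sum_congr rfl fun i _ => ?_
  rw [← Int.cast_smul_eq_zsmul ℝ]
  push_cast
  rfl

end Forms

/-- In a basis the map is polynomial in the coordinates. Forms are only algebraically multilinear,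
and differentiating them along a curve of arguments requires continuity. -/
theorem continuous_multilinearMap {ι E V : Type*} [Fintype ι] [DecidableEq ι]
    [NormedAddCommGroup E] [NormedSpace ℝ E] [FiniteDimensional ℝ E] [NormedAddCommGroup V]
    [NormedSpace ℝ V] (f : MultilinearMap ℝ (fun _ : ι => E) V) : Continuous f := by
  let e := Module.finBasis ℝ E
  have h : ∀ v : ι → E, f v = ∑ r : ι → Fin (Module.finrank ℝ E),
      (∏ l, e.equivFunL (v l) (r l)) • f fun l => e (r l) := by
    intro v
    conv_lhs => rw [show v = fun l => ∑ i, e.equivFunL (v l) i • e i from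
      funext fun l => (e.sum_equivFun (v l)).symm]
    rw [MultilinearMap.map_sum]
    exact Finset.sum_congr rfl fun r _ => f.map_smul_univ _ _
  rw [show (f : (ι → E) → V) = _ from funext h]
  fun_prop

/-! ### The vertical differential preserves basic elements -/

section Vertical

variable {E : Type*} [NormedAddCommGroup E] [NormedSpace ℝ E]
  {G : Type*} [TopologicalSpace G] [ChartedSpace E G] [Group G]
  {V : Type*} [NormedAddCommGroup V] [NormedSpace ℝ V]
  {ρ : Representation ℝ G V} {K : Subgroup G}

variable (E) in
/-- The representation `ρ` is smooth. -/
abbrev SmoothRep (ρ : Representation ℝ G V) : Prop :=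
  ContMDiff (𝓘(ℝ, E).prod 𝓘(ℝ, V)) 𝓘(ℝ, V) ∞ fun x : G × V => ρ x.1 x.2

section

variable {F : Type*} [NormedAddCommGroup F] [NormedSpace ℝ F] {H : Type*} [TopologicalSpace H]
  {J : ModelWithCorners ℝ F H} {N : Type*} [TopologicalSpace N] [ChartedSpace H N]

theorem contMDiff_const_smul (c : ℝ) {φ : N → V} (hφ : ContMDiff J 𝓘(ℝ, V) ∞ φ) :
    ContMDiff J 𝓘(ℝ, V) ∞ fun x => c • φ x :=
  (contMDiff_const (I' := 𝓘(ℝ, ℝ)) (c := c)).smul hφ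

theorem SmoothRep.comp (hρ : SmoothRep E ρ) {f : N → G} {φ : N → V}
    (hf : ContMDiff J 𝓘(ℝ, E) ∞ f) (hφ : ContMDiff J 𝓘(ℝ, V) ∞ φ) :
    ContMDiff J 𝓘(ℝ, V) ∞ fun x => ρ (f x) (φ x) :=
  ContMDiff.comp hρ (hf.prodMk hφ)

theorem contMDiff_bracketTerm {q : ℕ} {η : N → Cochain E G V q}
    (hη : ∀ ξ, ContMDiff J 𝓘(ℝ, V) ∞ fun y => η y ξ) (ξ : Fin (q + 1) → LieAlg E G) :
    ContMDiff J 𝓘(ℝ, V) ∞ fun y => bracketTerm (η y) ξ := by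
  cases q with
  | zero => exact contMDiff_const
  | succ q =>
    refine contMDiff_finsetSum fun j _ => contMDiff_finsetSum fun i _ => ?_
    split_ifs
    · exact contMDiff_const_smul _ (hη _)
    · exact contMDiff_const

theorem contMDiff_dCE [LieGroup 𝓘(ℝ, E) ∞ G] [IsManifold J ∞ N] (A : G → (N → V) → N → V)
    (hA : ∀ φ : N → V, ContMDiff J 𝓘(ℝ, V) ∞ φ →
      ContMDiff (J.prod 𝓘(ℝ, E)) 𝓘(ℝ, V) ∞ fun z : N × G => A z.2 φ z.1)
    {q : ℕ} {η : N → Cochain E G V q}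
    (hη : ∀ ξ, ContMDiff J 𝓘(ℝ, V) ∞ fun y => η y ξ) (ξ : Fin (q + 1) → LieAlg E G) :
    ContMDiff J 𝓘(ℝ, V) ∞ fun y => dCE A η y ξ := by
  refine ContMDiff.add ?_ (contMDiff_bracketTerm hη ξ)
  refine contMDiff_finsetSum fun i _ => contMDiff_const_smul _ ?_
  exact contMDiff_mfderiv_one (φ := fun x a => A a (fun y => η y (i.removeNth ξ)) x)
    (hA _ (hη _)) (ξ i)

end

variable [LieGroup 𝓘(ℝ, E) ∞ G]

theorem contMDiff_rightAct (hρ : SmoothRep E ρ) {p : ℕ} {φ : (Fin p → G) × G → V}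
    (hφ : ContMDiff ((powModel E p).prod 𝓘(ℝ, E)) 𝓘(ℝ, V) ∞ φ) :
    ContMDiff (((powModel E p).prod 𝓘(ℝ, E)).prod 𝓘(ℝ, E)) 𝓘(ℝ, V) ∞
      fun z : ((Fin p → G) × G) × G => rightAct ρ z.2 φ z.1 :=
  hρ.comp contMDiff_snd (hφ.comp ((contMDiff_fst.comp contMDiff_fst).prodMk
    ((contMDiff_snd.comp contMDiff_fst).mul contMDiff_snd)))

theorem mdifferentiableAt_rightAct (hρ : SmoothRep E ρ) {p : ℕ} {φ : (Fin p → G) × G → V}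
    (hφ : ContMDiff ((powModel E p).prod 𝓘(ℝ, E)) 𝓘(ℝ, V) ∞ φ) (y : (Fin p → G) × G) :
    MDifferentiableAt 𝓘(ℝ, E) 𝓘(ℝ, V) (fun a : G => rightAct ρ a φ y) 1 :=
  ((contMDiff_rightAct hρ hφ).comp
    ((contMDiff_const (c := y)).prodMk contMDiff_id)).mdifferentiableAt (by simp)

omit [LieGroup 𝓘(ℝ, E) ∞ G] in
/-- Precomposition of an alternating map with the adjoint action. -/
theorem IsForm.actForm {q : ℕ} {α : Cochain E G V q} (hα : IsForm α) (a : G) :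
    IsForm (actForm ρ a α) := by
  obtain ⟨β, hβ⟩ := hα
  exact ⟨(ρ a).compAlternatingMap (β.compLinearMap (AdLin a⁻¹)), fun ξ => congrArg (ρ a) (hβ _)⟩

variable [FiniteDimensional ℝ E]

theorem isForm_dCE_rightAct (hρ : SmoothRep E ρ) {p q : ℕ} {ψ : Dbl E G V p q}
    (hψ : ψ ∈ dblBasic E ρ K p q) (y : (Fin p → G) × G) : IsForm (dCE (rightAct ρ) ψ y) := by
  refine IsForm.add ?_ (isForm_bracketTerm (hψ.1 y))
  refine isForm_sum_mfderiv (η := fun a w => ρ a (ψ (y.1, y.2 * a) w)) (fun a => ?_) fun w =>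
    mdifferentiableAt_rightAct hρ (hψ.2.1 w) y
  obtain ⟨β, hβ⟩ := hψ.1 (y.1, y.2 * a)
  exact ⟨(ρ a).compAlternatingMap β, fun ξ => congrArg (ρ a) (hβ _)⟩

/-- The bracket term is natural because `Ad a` respects brackets. -/
theorem map_bracketTerm {W : Type*} [NormedAddCommGroup W] [NormedSpace ℝ W] (L : V →ₗ[ℝ] W)
    (a : G) {q : ℕ} (α : Cochain E G V q) (ξ : Fin (q + 1) → LieAlg E G) :
    L (bracketTerm α fun l => Ad E a (ξ l)) =
      bracketTerm (fun ζ => L (α fun l => Ad E a (ζ l))) ξ := by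
  cases q with
  | zero => exact map_zero L
  | succ q =>
    simp only [bracketTerm, map_sum]
    refine Finset.sum_congr rfl fun j _ => Finset.sum_congr rfl fun i _ => ?_
    split_ifs
    · rw [map_smul]
      congr 3
      funext l
      refine Fin.cases ?_ (fun l => ?_) l
      · exact (Ad_bracket a _ _).symm
      · rfl
    · exact map_zero L

variable [FiniteDimensional ℝ V]

/-- Equivariance of the Chevalley–Eilenberg differential: the direction `Ad k⁻¹ ξ` is traded for
conjugation of the group variable by `k⁻¹`, after which the invariance of `ψ` absorbs `k`. -/
theorem actForm_dCE_rightAct (hρ : SmoothRep E ρ) {p q : ℕ} {ψ : Dbl E G V p q}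
    (hψ : ψ ∈ dblBasic E ρ K p q) {k : G} (hk : k ∈ K) (g : Fin p → G) (x : G) :
    actForm ρ k (dCE (rightAct ρ) ψ (g, x * k)) = dCE (rightAct ρ) ψ (g, x) := by
  have hinv : ∀ x w, ρ k (ψ (g, x * k) fun l => Ad E k⁻¹ (w l)) = ψ (g, x) w := fun x w =>
    congrFun (hψ.2.2.1 k hk g x) w
  funext ξ
  simp only [actForm, dCE, map_add, map_sum, map_smul, map_bracketTerm, hinv]
  congr 1
  refine Finset.sum_congr rfl fun i _ => congrArg _ ?_
  have hd := mdifferentiableAt_rightAct hρ (hψ.2.1 (i.removeNth fun l => Ad E k⁻¹ (ξ l))) (g, x * k)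
  have hdc : MDifferentiableAt 𝓘(ℝ, E) 𝓘(ℝ, V) (fun b : G => rightAct ρ (k⁻¹ * b * k⁻¹⁻¹)
      (fun y => ψ y (i.removeNth fun l => Ad E k⁻¹ (ξ l))) (g, x * k)) 1 :=
    ((contMDiff_rightAct hρ (hψ.2.1 _)).comp ((contMDiff_const (c := (g, x * k))).prodMk
      (contMDiff_conj_right k⁻¹))).mdifferentiableAt (by simp)
  refine (congrArg (ρ k) (mfderiv_comp_conj hd k⁻¹ (ξ i)).symm).trans ?_
  refine (congrArg (fun T => T (ξ i)) (((LinearMap.toContinuousLinearMap (ρ k)).hasMFDerivAt.comp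
    (1 : G) hdc.hasMFDerivAt).mfderiv)).symm.trans ?_
  refine congrArg (fun f : G → V => (mfderiv 𝓘(ℝ, E) 𝓘(ℝ, V) f 1 (ξ i) : V)) (funext fun b => ?_)
  have e1 : x * k * (k⁻¹ * b * k⁻¹⁻¹) = x * b * k := by group
  have e2 : ∀ v, ρ k (ρ (k⁻¹ * b * k⁻¹⁻¹) v) = ρ b (ρ k v) := fun v => by
    simp only [← Module.End.mul_apply, ← map_mul]
    congr 2
    group
  simp only [Function.comp_apply, rightAct, LinearMap.coe_toContinuousLinearMap', e1, e2]
  exact congrArg (ρ b) (hinv (x * b) (i.removeNth ξ))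

omit [FiniteDimensional ℝ V] in
/-- Cartan's formula on basic elements: the infinitesimal action of `ζ ∈ 𝔨` is cancelled by the
coadjoint action. -/
theorem infAct_rightAct_eq_sum (hρ : SmoothRep E ρ) {p q : ℕ} {ψ : Dbl E G V p q}
    (hψ : ψ ∈ dblBasic E ρ K p q) {ζ : LieAlg E G} (hζ : ζ ∈ lieOf E K)
    (y : (Fin p → G) × G) (w : Fin q → LieAlg E G) :
    infAct (rightAct ρ) ζ (fun y => ψ y w) y =
      ∑ j, ψ y (Function.update w j ⁅ζ, w j⁆) := by
  obtain ⟨γ, hγ, hγK, h1, hv⟩ := hζ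
  have hγ0 : MDifferentiableAt 𝓘(ℝ, ℝ) 𝓘(ℝ, E) γ 0 := hγ.mdifferentiableAt (by simp)
  obtain ⟨β, hβ⟩ := hψ.1 y
  let b : MultilinearMap ℝ (fun _ : Fin q => E) V := β.toMultilinearMap
  let bc : ContinuousMultilinearMap ℝ (fun _ : Fin q => E) V :=
    ⟨b, continuous_multilinearMap b⟩
  have hright : HasDerivAt (fun t => ψ y fun l => Ad E (γ t) (w l))
      (∑ j, ψ y (Function.update w j ⁅ζ, w j⁆)) 0 := by
    have h := HasFDerivAt.comp_hasDerivAt (0 : ℝ) (bc.hasFDerivAt _)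
      (hasDerivAt_pi.2 fun l => hasDerivAt_Ad hγ0 h1 hv (w l))
    refine (h.congr_of_eventuallyEq (.of_forall fun t => hβ _)).congr_deriv ?_
    refine (ContinuousMultilinearMap.linearDeriv_apply _ _ _).trans ?_
    refine Finset.sum_congr rfl fun j _ => Eq.trans ?_ (hβ _).symm
    refine congrArg b ?_
    have : (fun l => Ad E (γ 0) (w l)) = w := by
      funext l
      rw [h1, Ad_one]
    exact congrArg (fun u : Fin q → E => Function.update u j (⁅ζ, w j⁆ : LieAlg E G)) this
  have hleft : HasDerivAt (fun t => rightAct ρ (γ t) (fun y => ψ y w) y)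
      (infAct (rightAct ρ) ζ (fun y => ψ y w) y) 0 := by
    have hd := mdifferentiableAt_rightAct hρ (hψ.2.1 w) y
    rw [← h1] at hd
    let L : ℝ →L[ℝ] V := (mfderiv 𝓘(ℝ, E) 𝓘(ℝ, V)
      (fun a : G => rightAct ρ a (fun y => ψ y w) y) (γ 0)).comp (mfderiv 𝓘(ℝ, ℝ) 𝓘(ℝ, E) γ 0)
    have hL : HasFDerivAt (fun t => rightAct ρ (γ t) (fun y => ψ y w) y) L 0 :=
      hasMFDerivAt_iff_hasFDerivAt.1 (hd.hasMFDerivAt.comp (0 : ℝ) hγ0.hasMFDerivAt)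
    have h := hL.hasDerivAt
    refine h.congr_deriv ((mfderiv_congr_point h1 _).trans ?_)
    exact congrArg (fun v : E => (mfderiv 𝓘(ℝ, E) 𝓘(ℝ, V)
      (fun a : G => rightAct ρ a (fun y => ψ y w) y) 1 v : V)) hv
  -- Invariance of `ψ` under `γ t ∈ K`, evaluated on `Ad (γ t) w`, identifies the two curves.
  refine hleft.unique (hright.congr_of_eventuallyEq (.of_forall fun t => ?_))
  have := congrFun (hψ.2.2.1 (γ t) (hγK t) y.1 y.2) fun l => Ad E (γ t) (w l)
  simp only [actForm, Ad_inv_Ad] at this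
  exact this

omit [LieGroup 𝓘(ℝ, E) ∞ G] [FiniteDimensional ℝ E] [FiniteDimensional ℝ V] in
-- A pair that avoids the first position leaves `ζ` among the arguments, so horizontality kills it.
-- In the other pairs, moving the bracket from the front into position `j` produces the sign.
theorem bracketTerm_cons {q : ℕ} {α : Cochain E G V q} (hα : IsForm α) (hK : IsHorizontal K α)
    {ζ : LieAlg E G} (hζ : ζ ∈ lieOf E K) (w : Fin q → LieAlg E G) :
    bracketTerm α (Fin.cons ζ w) = -∑ j, α (Function.update w j ⁅ζ, w j⁆) := by
  obtain ⟨β, hβ⟩ := hα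
  cases q with
  | zero => simp [bracketTerm]
  | succ q =>
    simp only [bracketTerm]
    rw [Fin.sum_univ_succ, Finset.sum_eq_zero fun i _ => if_neg (Fin.not_lt_zero _), zero_add,
      ← Finset.sum_neg_distrib]
    refine Finset.sum_congr rfl fun j _ => ?_
    rw [Finset.sum_eq_single 0]
    · have h0 : (0 : Fin (q + 1)).castSucc < j.succ := by simp [Fin.lt_def]
      rw [if_pos h0]
      have e1 : (0 : Fin (q + 1)).removeNth (j.succ.removeNth
          (Fin.cons ζ w : Fin (q + 2) → LieAlg E G)) = j.removeNth w := by
        funext l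
        simp [Fin.removeNth_apply]
      have e2 : Function.update w j ⁅ζ, w j⁆ = j.insertNth ⁅ζ, w j⁆ (j.removeNth w) := by
        rw [Fin.insertNth_removeNth]
      rw [e1, e2, hβ, hβ, AlternatingMap.map_insertNth, ← Int.cast_smul_eq_zsmul ℝ, ← neg_smul]
      congr 1
      push_cast
      rw [Fin.val_succ, Fin.val_zero]
      ring
    · intro i _ hi
      split_ifs with hij
      · rw [hK, smul_zero]
        have hq : 0 < q := by
          have := i.isLt
          have : i.val ≠ 0 := fun h => hi (Fin.ext h)
          omega
        obtain ⟨q, rfl⟩ := Nat.exists_eq_succ_of_ne_zero hq.ne'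
        refine ⟨Fin.succ 0, ?_⟩
        rw [Fin.cons_succ, Fin.removeNth_apply, Fin.removeNth_apply,
          Fin.succAbove_ne_zero_zero hi, Fin.succAbove_ne_zero_zero (Fin.succ_ne_zero j),
          Fin.cons_zero]
        exact hζ
      · rfl
    · simp

/-- Terms differentiating along another argument keep `ζ` inside `ψ`, which is then identically
zero; the term along `ζ` cancels the bracket term by Cartan's formula. -/
theorem dCE_rightAct_cons (hρ : SmoothRep E ρ) {p q : ℕ} {ψ : Dbl E G V p q}
    (hψ : ψ ∈ dblBasic E ρ K p q) {ζ : LieAlg E G} (hζ : ζ ∈ lieOf E K)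
    (y : (Fin p → G) × G) (w : Fin q → LieAlg E G) :
    dCE (rightAct ρ) ψ y (Fin.cons ζ w) = 0 := by
  simp only [dCE]
  rw [bracketTerm_cons (hψ.1 y) (hψ.2.2.2 y) hζ, Fin.sum_univ_succ]
  have h0 : ∀ i : Fin q, infAct (rightAct ρ) ((Fin.cons ζ w : Fin (q + 1) → LieAlg E G) i.succ)
      (fun y => ψ y (i.succ.removeNth (Fin.cons ζ w : Fin (q + 1) → LieAlg E G))) y = 0 := by
    intro i
    have e : (fun y => ψ y (i.succ.removeNth (Fin.cons ζ w : Fin (q + 1) → LieAlg E G))) = 0 := by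
      funext z
      obtain ⟨q, rfl⟩ := Nat.exists_eq_succ_of_ne_zero i.pos.ne'
      refine hψ.2.2.2 z _ ⟨0, ?_⟩
      rw [Fin.removeNth_apply, Fin.succAbove_ne_zero_zero (Fin.succ_ne_zero i), Fin.cons_zero]
      exact hζ
    rw [e]
    refine (congrArg (fun f : G → V => (mfderiv 𝓘(ℝ, E) 𝓘(ℝ, V) f 1 _ : V))
      (funext fun a => map_zero (ρ a))).trans ?_
    exact congrArg (fun L => L ((Fin.cons ζ w : Fin (q + 1) → LieAlg E G) i.succ)) (mfderiv_const (I := 𝓘(ℝ, E)) (I' := 𝓘(ℝ, V)) (M := G) (x := 1)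
      (c := (0 : V)))
  have e : (0 : Fin (q + 1)).removeNth (Fin.cons ζ w : Fin (q + 1) → LieAlg E G) = w := rfl
  simp only [h0, smul_zero, Finset.sum_const_zero, add_zero, Fin.val_zero, pow_zero, one_smul,
    Fin.cons_zero, e, infAct_rightAct_eq_sum hρ hψ hζ, add_neg_cancel]

theorem isHorizontal_dCE_rightAct (hρ : SmoothRep E ρ) {p q : ℕ} {ψ : Dbl E G V p q}
    (hψ : ψ ∈ dblBasic E ρ K p q) (y : (Fin p → G) × G) :
    IsHorizontal K (dCE (rightAct ρ) ψ y) := by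
  rintro ξ ⟨l, hl⟩
  obtain ⟨β, hβ⟩ := isForm_dCE_rightAct hρ hψ y
  have hcons : ∀ ξ : Fin (q + 1) → LieAlg E G, ξ 0 ∈ lieOf E K →
      dCE (rightAct ρ) ψ y ξ = 0 := by
    intro ξ hξ
    rw [← Fin.cons_self_tail ξ]
    exact dCE_rightAct_cons hρ hψ hξ y _
  by_cases h0 : l = 0
  · subst h0
    exact hcons ξ hl
  · have h := hcons (ξ ∘ Equiv.swap 0 l) (by simpa using hl)
    rw [hβ, β.map_swap ξ (Ne.symm h0), neg_eq_zero] at h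
    rw [hβ, h]

omit [FiniteDimensional ℝ E] [LieGroup 𝓘(ℝ, E) ∞ G] [FiniteDimensional ℝ V] in
theorem add_mem_dblBasic {p q : ℕ} {ψ φ : Dbl E G V p q} (hψ : ψ ∈ dblBasic E ρ K p q)
    (hφ : φ ∈ dblBasic E ρ K p q) : ψ + φ ∈ dblBasic E ρ K p q := by
  refine ⟨fun y => (hψ.1 y).add (hφ.1 y), fun ξ => (hψ.2.1 ξ).add (hφ.2.1 ξ), fun k hk g x => ?_,
    fun y ξ hξ => ?_⟩
  · refine Eq.trans ?_ (congrArg₂ (· + ·) (hψ.2.2.1 k hk g x) (hφ.2.2.1 k hk g x))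
    exact funext fun ξ => map_add (ρ k) _ _
  · exact (congrArg₂ (· + ·) (hψ.2.2.2 y ξ hξ) (hφ.2.2.2 y ξ hξ)).trans (add_zero 0)

omit [FiniteDimensional ℝ E] [LieGroup 𝓘(ℝ, E) ∞ G] [FiniteDimensional ℝ V] in
theorem smul_mem_dblBasic {p q : ℕ} {ψ : Dbl E G V p q} (c : ℝ) (hψ : ψ ∈ dblBasic E ρ K p q) :
    c • ψ ∈ dblBasic E ρ K p q := by
  refine ⟨fun y => (hψ.1 y).smul c, fun ξ => contMDiff_const_smul c (hψ.2.1 ξ),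
    fun k hk g x => ?_, fun y ξ hξ => ?_⟩
  · refine Eq.trans ?_ (congrArg (fun α => c • α) (hψ.2.2.1 k hk g x))
    exact funext fun ξ => map_smul (ρ k) _ _
  · exact (congrArg (c • ·) (hψ.2.2.2 y ξ hξ)).trans (smul_zero c)

omit [FiniteDimensional ℝ E] [LieGroup 𝓘(ℝ, E) ∞ G] [FiniteDimensional ℝ V] in
theorem zero_mem_dblBasic {p q : ℕ} : (0 : Dbl E G V p q) ∈ dblBasic E ρ K p q :=
  ⟨fun _ => IsForm.zero, fun _ => contMDiff_const, fun k _ _ _ => funext fun _ => map_zero (ρ k),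
    fun _ _ _ => rfl⟩

theorem dVer_mem_dblBasic (hρ : SmoothRep E ρ) {p q : ℕ} {ψ : Dbl E G V p q}
    (hψ : ψ ∈ dblBasic E ρ K p q) : dVer ρ ψ ∈ dblBasic E ρ K p (q + 1) :=
  smul_mem_dblBasic _ ⟨isForm_dCE_rightAct hρ hψ,
    contMDiff_dCE (rightAct ρ) (fun _ hφ => contMDiff_rightAct hρ hφ) hψ.2.1,
    fun _ hk => actForm_dCE_rightAct hρ hψ hk, isHorizontal_dCE_rightAct hρ hψ⟩

end Vertical

/-! ### The horizontal differential preserves basic elements -/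

section Horizontal

variable {E : Type*} [NormedAddCommGroup E] [NormedSpace ℝ E]
  {G : Type*} [TopologicalSpace G] [ChartedSpace E G] [Group G]
  {V : Type*} [NormedAddCommGroup V] [NormedSpace ℝ V]
  {ρ : Representation ℝ G V} {K : Subgroup G}

theorem sum_mem_dblBasic {p q : ℕ} {ι : Type*} (s : Finset ι) {ψ : ι → Dbl E G V p q}
    (hψ : ∀ i, ψ i ∈ dblBasic E ρ K p q) : ∑ i ∈ s, ψ i ∈ dblBasic E ρ K p q := by
  classical
  induction s using Finset.induction_on with
  | empty => exact zero_mem_dblBasic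
  | insert i s hi ih =>
    rw [Finset.sum_insert hi]
    exact add_mem_dblBasic (hψ i) ih

variable [LieGroup 𝓘(ℝ, E) ∞ G]

/-- Left multiplication of the last variable commutes with the right translations in the `K`-action.
Every face in `δ` has this shape. -/
theorem comp_mem_dblBasic {p p' q : ℕ} {ψ : Dbl E G V p q} (hψ : ψ ∈ dblBasic E ρ K p q)
    {u : (Fin p' → G) → Fin p → G} {v : (Fin p' → G) → G}
    (hu : ContMDiff (powModel E p') (powModel E p) ∞ u)
    (hv : ContMDiff (powModel E p') 𝓘(ℝ, E) ∞ v) :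
    (fun y => ψ (u y.1, v y.1 * y.2) : Dbl E G V p' q) ∈ dblBasic E ρ K p' q := by
  refine ⟨fun y => hψ.1 _, fun ξ => (hψ.2.1 ξ).comp
    ((hu.comp contMDiff_fst).prodMk ((hv.comp contMDiff_fst).mul contMDiff_snd)),
    fun k hk g x => ?_, fun y => hψ.2.2.2 _⟩
  have h := hψ.2.2.1 k hk (u g) (v g * x)
  rw [mul_assoc] at h
  exact h

theorem contMDiff_tail {p : ℕ} :
    ContMDiff (powModel E (p + 1)) (powModel E p) ∞ fun g : Fin (p + 1) → G => Fin.tail g :=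
  contMDiff_powModel fun i => contMDiff_eval i.succ

theorem contMDiff_init {p : ℕ} :
    ContMDiff (powModel E (p + 1)) (powModel E p) ∞ fun g : Fin (p + 1) → G =>
      (Fin.init g : Fin p → G) :=
  contMDiff_powModel fun i => contMDiff_eval i.castSucc

theorem contMDiff_contractNth {p : ℕ} (j : Fin (p + 1)) :
    ContMDiff (powModel E (p + 1)) (powModel E p) ∞ fun g : Fin (p + 1) → G =>
      Fin.contractNth j (fun a b => a * b) g := by
  refine contMDiff_powModel fun i => ?_
  simp only [Fin.contractNth]
  split_ifs
  · exact contMDiff_eval _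
  · exact (contMDiff_eval _).mul (contMDiff_eval _)
  · exact contMDiff_eval _

theorem dHor_mem_dblBasic {p q : ℕ} {ψ : Dbl E G V p q} (hψ : ψ ∈ dblBasic E ρ K p q) :
    dHor ψ ∈ dblBasic E ρ K (p + 1) q := by
  have h1 := comp_mem_dblBasic hψ (contMDiff_tail (E := E) (G := G)) (contMDiff_const (c := 1))
  have h2 := fun i : Fin p => smul_mem_dblBasic ((-1 : ℝ) ^ (i.val + 1)) (comp_mem_dblBasic hψ
    (contMDiff_contractNth (E := E) (G := G) i.castSucc) (contMDiff_const (c := 1)))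
  have h3 := smul_mem_dblBasic ((-1 : ℝ) ^ (p + 1)) (comp_mem_dblBasic hψ
    (contMDiff_init (E := E) (G := G)) (contMDiff_eval (Fin.last p)))
  convert add_mem_dblBasic (add_mem_dblBasic h1 (sum_mem_dblBasic Finset.univ h2)) h3 using 1
  funext y ξ
  simp [dHor, Finset.sum_apply]

end Horizontal

/-! ### Homotopy, projection and augmentations -/

section Averages

variable {E : Type*} [NormedAddCommGroup E] [NormedSpace ℝ E]
  {G : Type*} [TopologicalSpace G] [ChartedSpace E G] [Group G]
  {V : Type*} [NormedAddCommGroup V] [NormedSpace ℝ V]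
  {ρ : Representation ℝ G V} {K : Subgroup G}

theorem isForm_integral {X : Type*} [MeasurableSpace X] {μ : Measure X} {q : ℕ}
    {α : X → Cochain E G V q} (hα : ∀ x, IsForm (α x)) (hi : ∀ ξ, Integrable (fun x => α x ξ) μ) :
    IsForm fun ξ => ∫ x, α x ξ ∂μ := by
  choose β hβ using hα
  simp only [hβ] at hi ⊢
  refine ⟨
    { toFun := fun ξ => ∫ x, β x ξ ∂μ
      map_update_add' := fun w l a b => ?_
      map_update_smul' := fun w l c a => ?_
      map_eq_zero_of_eq' := fun w l l' h hl => ?_ }, fun ξ => rfl⟩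
  · simp only [AlternatingMap.map_update_add]
    exact integral_add (hi _) (hi _)
  · simp only [AlternatingMap.map_update_smul]
    exact integral_smul c _
  · simp only [AlternatingMap.map_eq_zero_of_eq _ w h hl]
    exact integral_zero _ _

theorem contMDiff_snoc {F : Type*} [NormedAddCommGroup F] [NormedSpace ℝ F] {H : Type*}
    [TopologicalSpace H] {J : ModelWithCorners ℝ F H} {N : Type*} [TopologicalSpace N]
    [ChartedSpace H N] {p : ℕ} {f : N → Fin p → G} {φ : N → G}
    (hf : ContMDiff J (powModel E p) ∞ f) (hφ : ContMDiff J 𝓘(ℝ, E) ∞ φ) :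
    ContMDiff J (powModel E (p + 1)) ∞ fun x => (Fin.snoc (f x) (φ x) : Fin (p + 1) → G) := by
  refine contMDiff_powModel fun i => ?_
  refine Fin.lastCases ?_ (fun i => ?_) i
  · simpa only [Fin.snoc_last] using hφ
  · simp only [Fin.snoc_castSucc]
    exact (contMDiff_eval i).comp hf

variable [FiniteDimensional ℝ E] [FiniteDimensional ℝ V] [LieGroup 𝓘(ℝ, E) ∞ G]
  [MeasurableSpace G] [BorelSpace G] [CompactSpace K]

theorem contMDiff_hK_integrand {p q : ℕ} {ψ : Dbl E G V (p + 1) q}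
    (hψ : ψ ∈ dblBasic E ρ K (p + 1) q) (ξ : Fin q → LieAlg E G) :
    ContMDiff (((powModel E p).prod 𝓘(ℝ, E)).prod 𝓘(ℝ, E)) 𝓘(ℝ, V) ∞
      fun z : ((Fin p → G) × G) × G => ψ (Fin.snoc z.1.1 (z.1.2 * z.2⁻¹), z.2) ξ :=
  (hψ.2.1 ξ).comp ((contMDiff_snoc (contMDiff_fst.comp contMDiff_fst)
    ((contMDiff_snd.comp contMDiff_fst).mul contMDiff_snd.inv)).prodMk contMDiff_snd)

theorem integrable_hK {p q : ℕ} {ψ : Dbl E G V (p + 1) q}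
    (hψ : ψ ∈ dblBasic E ρ K (p + 1) q) (ξ : Fin q → LieAlg E G) (g : Fin p → G) (x : G) :
    Integrable (fun k : K => ψ (Fin.snoc g (x * (k : G)⁻¹), (k : G)) ξ) (haarK E K) :=
  integrable_of_continuous _ ((contMDiff_hK_integrand hψ ξ).continuous.comp
    ((Continuous.prodMk_right (g, x)).comp continuous_subtype_val))

theorem integrable_prK {q : ℕ} {ψ : Dbl E G V 0 q}
    (hψ : ψ ∈ dblBasic E ρ K 0 q) (ξ : Fin q → LieAlg E G) :
    Integrable (fun k : K => ψ (Fin.elim0, (k : G)) ξ) (haarK E K) :=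
  integrable_of_continuous _ ((hψ.2.1 ξ).continuous.comp
    ((Continuous.prodMk_right (Fin.elim0 : Fin 0 → G)).comp continuous_subtype_val))

theorem map_integral {X : Type*} [MeasurableSpace X] {μ : Measure X} (L : V →ₗ[ℝ] V) {f : X → V}
    (hf : Integrable f μ) : L (∫ x, f x ∂μ) = ∫ x, L (f x) ∂μ :=
  ((LinearMap.toContinuousLinearMap L).integral_comp_comm hf).symm

theorem hK_mem_dblBasic {p q : ℕ} {ψ : Dbl E G V (p + 1) q}
    (hψ : ψ ∈ dblBasic E ρ K (p + 1) q) : hK K ψ ∈ dblBasic E ρ K p q := by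
  refine smul_mem_dblBasic ((-1 : ℝ) ^ (p + 1)) (ψ := fun y ξ =>
    ∫ k : K, ψ (Fin.snoc y.1 (y.2 * (k : G)⁻¹), (k : G)) ξ ∂(haarK E K)) ⟨fun y => ?_, fun ξ => ?_,
      fun a ha g x => ?_, fun y ξ hξ => ?_⟩
  · exact isForm_integral (fun k => hψ.1 _) fun ξ => integrable_hK hψ ξ y.1 y.2
  · exact contMDiff_integral (haarK E K) (contMDiff_hK_integrand hψ ξ) continuous_subtype_val
  · funext ξ
    simp only [actForm]
    -- Substitute `k a` for `k`: then `x a (k a)⁻¹ = x k⁻¹`, and the last variable `k a` is handled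
    -- by the invariance of `ψ`.
    rw [map_integral _ (integrable_hK hψ _ g (x * a)), ← integral_haarK_mul_right K _ ⟨a, ha⟩]
    refine integral_congr_ae (.of_forall fun k => ?_)
    have h := congrFun (hψ.2.2.1 a ha (Fin.snoc g (x * (k : G)⁻¹)) k) ξ
    have e : x * a * ((k * ⟨a, ha⟩ : K) : G)⁻¹ = x * (k : G)⁻¹ := by
      simp only [Subgroup.coe_mul]
      group
    simp only [e]
    exact h
  · simp only [hψ.2.2.2 _ ξ hξ, integral_zero]

theorem prK_mem_lieBasic {q : ℕ} {ψ : Dbl E G V 0 q}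
    (hψ : ψ ∈ dblBasic E ρ K 0 q) : prK K ψ ∈ lieBasic E ρ K q := by
  refine ⟨isForm_integral (fun k => hψ.1 _) fun ξ => integrable_prK hψ ξ, fun a ha => ?_,
    fun ξ hξ => ?_⟩
  · funext ξ
    simp only [actForm, prK]
    rw [map_integral _ (integrable_prK hψ _), ← integral_haarK_mul_right K _ ⟨a, ha⟩]
    exact integral_congr_ae (.of_forall fun k => congrFun (hψ.2.2.1 a ha Fin.elim0 k) ξ)
  · simp only [prK, hψ.2.2.2 _ ξ hξ, integral_zero]

theorem iAug_mem_dblBasic {q : ℕ} {α : Cochain E G V q} (hα : α ∈ lieBasic E ρ K q) :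
    iAug α ∈ dblBasic E ρ K 0 q :=
  ⟨fun _ => hα.1, fun _ => contMDiff_const, fun k hk _ _ => hα.2.1 k hk, fun _ => hα.2.2⟩

theorem prK_iAug {q : ℕ} (α : Cochain E G V q) : prK K (iAug α) = α := by
  funext ξ
  simp [prK, iAug]

theorem jAug_mem_dblBasic (hρ : SmoothRep E ρ) {p : ℕ} {f : (Fin p → G) → V}
    (hf : f ∈ groupCochains E G V p) : jAug E ρ f ∈ dblBasic E ρ K p 0 := by
  refine ⟨fun y => ?_, fun ξ => hρ.comp contMDiff_snd.inv (ContMDiff.comp hf contMDiff_fst),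
    fun k hk g x => ?_, fun y ξ ⟨l, _⟩ => l.elim0⟩
  · exact ⟨AlternatingMap.constOfIsEmpty ℝ _ _ (ρ y.2⁻¹ (f y.1)), fun ξ => rfl⟩
  · funext ξ
    simp only [actForm, jAug, ← Module.End.mul_apply, ← map_mul]
    congr 2
    group

theorem tail_snoc {p : ℕ} (g : Fin (p + 1) → G) (y : G) :
    (Fin.tail (Fin.snoc g y : Fin (p + 2) → G) : Fin (p + 1) → G) = Fin.snoc (Fin.tail g) y := by
  funext l
  refine Fin.lastCases ?_ (fun l => ?_) l
  · rw [Fin.snoc_last]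
    exact Fin.snoc_last (α := fun _ => G) y g
  · rw [Fin.snoc_castSucc]
    exact Fin.snoc_castSucc (α := fun _ => G) y g l.succ

theorem contractNth_castSucc_snoc {p : ℕ} (g : Fin (p + 1) → G) (y : G) (i : Fin p) :
    Fin.contractNth i.castSucc.castSucc (fun a b => a * b) (Fin.snoc g y : Fin (p + 2) → G) =
      Fin.snoc (Fin.contractNth i.castSucc (fun a b => a * b) g) y := by
  funext l
  refine Fin.lastCases ?_ (fun l => ?_) l
  · have h1 : ¬ p < i.val := by omega
    have h2 : p ≠ i.val := by omega
    simp [Fin.contractNth, h1, h2]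
  · simp only [Fin.contractNth, Fin.snoc_castSucc, Fin.val_castSucc, Fin.succ_castSucc]

theorem contractNth_last_snoc {p : ℕ} (g : Fin (p + 1) → G) (y : G) :
    Fin.contractNth (Fin.last p).castSucc (fun a b => a * b) (Fin.snoc g y : Fin (p + 2) → G) =
      Fin.snoc (Fin.init g) (g (Fin.last p) * y) := by
  funext l
  refine Fin.lastCases ?_ (fun l => ?_) l
  · simp [Fin.contractNth]
  · simp [Fin.contractNth, Fin.init]

/-- The two faces at `(x k⁻¹; k)` are `ψ(k)` and `ψ(x k⁻¹ k) = ψ(x)`; the second does not depend on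
`k`. -/
theorem hK_dHor_zero {q : ℕ} {ψ : Dbl E G V 0 q} (hψ : ψ ∈ dblBasic E ρ K 0 q) :
    hK K (dHor ψ) = ψ - iAug (prK K ψ) := by
  funext ⟨g, x⟩ ξ
  obtain rfl : g = Fin.elim0 := Subsingleton.elim _ _
  have e : ∀ k : K, dHor ψ (Fin.snoc Fin.elim0 (x * (k : G)⁻¹), (k : G)) ξ =
      ψ (Fin.elim0, (k : G)) ξ - ψ (Fin.elim0, x) ξ := by
    intro k
    have h1 : (Fin.tail (Fin.snoc Fin.elim0 (x * (k : G)⁻¹) : Fin 1 → G) : Fin 0 → G) =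
        Fin.elim0 := Subsingleton.elim _ _
    have h2 : (Fin.init (Fin.snoc Fin.elim0 (x * (k : G)⁻¹) : Fin 1 → G) : Fin 0 → G) =
        Fin.elim0 := Subsingleton.elim _ _
    have h3 : (Fin.snoc Fin.elim0 (x * (k : G)⁻¹) : Fin 1 → G) (Fin.last 0) = x * (k : G)⁻¹ :=
      Fin.snoc_last _ _
    simp only [dHor, Pi.add_apply, Pi.smul_apply, Finset.univ_eq_empty, Finset.sum_empty,
      h1, h2, h3, inv_mul_cancel_right]
    simp [sub_eq_add_neg]
  simp only [hK, e]
  rw [integral_sub (integrable_prK hψ ξ) (integrable_const _)]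
  simp [iAug, prK]

/-- Among the faces at `(g, x k⁻¹; k)`, the last is `ψ(g; x)`, since `x k⁻¹ k = x`, and survives.
The one before it multiplies `g_{p+1}` into `x`, giving the last face of `hψ`; the others act on `g`
alone. So all except the last appear in `δhψ` with the opposite sign. -/
theorem hK_dHor_add {p q : ℕ} {ψ : Dbl E G V (p + 1) q} (hψ : ψ ∈ dblBasic E ρ K (p + 1) q) :
    hK K (dHor ψ) + dHor (hK K ψ) = ψ := by
  funext ⟨g, x⟩ ξ
  have e : ∀ k : K, dHor ψ (Fin.snoc g (x * (k : G)⁻¹), (k : G)) ξ =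
      ψ (Fin.snoc (Fin.tail g) (x * (k : G)⁻¹), (k : G)) ξ +
      ∑ i : Fin p, (-1 : ℝ) ^ (i.val + 1) •
        ψ (Fin.snoc (Fin.contractNth i.castSucc (fun a b => a * b) g) (x * (k : G)⁻¹), (k : G)) ξ +
      (-1 : ℝ) ^ (p + 1) •
        ψ (Fin.snoc (Fin.init g) (g (Fin.last p) * x * (k : G)⁻¹), (k : G)) ξ +
      (-1 : ℝ) ^ (p + 2) • ψ (g, x) ξ := by
    intro k
    simp only [dHor, Pi.add_apply, Finset.sum_apply, Pi.smul_apply, Fin.sum_univ_castSucc,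
      tail_snoc, contractNth_castSucc_snoc, contractNth_last_snoc, Fin.init_snoc, Fin.snoc_last,
      inv_mul_cancel_right, Fin.val_castSucc, Fin.val_last, ← add_assoc, ← mul_assoc]
  have hi := fun g x => integrable_hK (K := K) hψ ξ g x
  have hs : Integrable (fun k : K => ∑ i : Fin p, (-1 : ℝ) ^ (i.val + 1) •
        ψ (Fin.snoc (Fin.contractNth i.castSucc (fun a b => a * b) g) (x * (k : G)⁻¹), (k : G)) ξ)
      (haarK E K) := integrable_finsetSum _ fun i _ => (hi _ _).smul _
  have hI : ∫ k : K, dHor ψ (Fin.snoc g (x * (k : G)⁻¹), (k : G)) ξ ∂(haarK E K) =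
      ∫ k : K, ψ (Fin.snoc (Fin.tail g) (x * (k : G)⁻¹), (k : G)) ξ ∂(haarK E K) +
      ∑ i : Fin p, (-1 : ℝ) ^ (i.val + 1) • ∫ k : K,
        ψ (Fin.snoc (Fin.contractNth i.castSucc (fun a b => a * b) g) (x * (k : G)⁻¹), (k : G)) ξ
          ∂(haarK E K) +
      (-1 : ℝ) ^ (p + 1) • ∫ k : K,
        ψ (Fin.snoc (Fin.init g) (g (Fin.last p) * x * (k : G)⁻¹), (k : G)) ξ ∂(haarK E K) +
      (-1 : ℝ) ^ (p + 2) • ψ (g, x) ξ := by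
    simp only [e]
    have h0 := hi (Fin.tail g) x
    have h2 := (hi (Fin.init g) (g (Fin.last p) * x)).smul ((-1 : ℝ) ^ (p + 1))
    refine (integral_add ((h0.add hs).add h2) (integrable_const _)).trans ?_
    refine congrArg₂ (· + ·) ((integral_add (h0.add hs) h2).trans (congrArg₂ (· + ·)
      ((integral_add h0 hs).trans (congrArg₂ (· + ·) rfl ?_)) (integral_smul _ _))) ?_
    · exact (integral_finsetSum _ fun i _ => (hi _ _).smul _).trans
        (Finset.sum_congr rfl fun i _ => integral_smul _ _)
    · simp only [integral_const, probReal_univ, one_smul]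
  have hL : hK K (dHor ψ) (g, x) ξ = (-1 : ℝ) ^ (p + 2) • _ :=
    congrArg (fun v => (-1 : ℝ) ^ (p + 2) • v) hI
  have hR : dHor (hK K ψ) (g, x) ξ = (-1 : ℝ) ^ (p + 1) •
      (∫ k : K, ψ (Fin.snoc (Fin.tail g) (x * (k : G)⁻¹), (k : G)) ξ ∂(haarK E K) +
      ∑ i : Fin p, (-1 : ℝ) ^ (i.val + 1) • ∫ k : K,
        ψ (Fin.snoc (Fin.contractNth i.castSucc (fun a b => a * b) g) (x * (k : G)⁻¹), (k : G)) ξ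
          ∂(haarK E K) +
      (-1 : ℝ) ^ (p + 1) • ∫ k : K,
        ψ (Fin.snoc (Fin.init g) (g (Fin.last p) * x * (k : G)⁻¹), (k : G)) ξ ∂(haarK E K)) := by
    simp only [dHor, hK, Pi.add_apply, Finset.sum_apply, Pi.smul_apply, smul_add, Finset.smul_sum,
      smul_comm ((-1 : ℝ) ^ (p + 1))]
  have hsq : (-1 : ℝ) ^ (p + 2) * (-1) ^ (p + 2) = 1 := by
    rw [← mul_pow]
    norm_num
  rw [Pi.add_apply, Pi.add_apply, hL, hR, smul_add, smul_smul, hsq, one_smul, pow_succ _ (p + 1),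
    mul_neg_one, neg_smul]
  abel

end Averages

/-! ### Inverting `1 + dh` -/

section TotalComplex

variable {E : Type*} [NormedAddCommGroup E] [NormedSpace ℝ E]
  {G : Type*} [TopologicalSpace G] [ChartedSpace E G] [Group G]
  {V : Type*} [NormedAddCommGroup V] [NormedSpace ℝ V]
  {ρ : Representation ℝ G V} {K : Subgroup G}

theorem dVer_zero {p q : ℕ} : dVer ρ (0 : Dbl E G V p q) = 0 := by
  have h1 : ∀ (ξ : LieAlg E G) (x : (Fin p → G) × G),
      infAct (rightAct ρ) ξ (fun _ => (0 : V)) x = 0 := by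
    intro ξ x
    have h : (fun a : G => rightAct ρ a (fun _ : (Fin p → G) × G => (0 : V)) x) = fun _ => 0 := by
      funext a
      exact map_zero _
    refine (congrArg (fun f : G → V => (mfderiv 𝓘(ℝ, E) 𝓘(ℝ, V) f 1 ξ : V)) h).trans ?_
    exact congrArg (fun L => L ξ) (mfderiv_const (I := 𝓘(ℝ, E)) (I' := 𝓘(ℝ, V)) (c := (0 : V)))
  have h2 : ∀ ξ, bracketTerm (0 : Cochain E G V q) ξ = 0 := by
    intro ξ
    cases q <;> simp [bracketTerm]
  have h3 : dCE (rightAct ρ) (0 : Dbl E G V p q) = 0 := by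
    funext x ξ
    refine (congrArg₂ (· + ·) (Finset.sum_eq_zero fun i _ => ?_) (h2 ξ)).trans (add_zero _)
    exact (congrArg _ (h1 (ξ i) x)).trans (smul_zero _)
  rw [dVer, h3, smul_zero]

theorem sub_mem_dblBasic {p q : ℕ} {ψ φ : Dbl E G V p q} (hψ : ψ ∈ dblBasic E ρ K p q)
    (hφ : φ ∈ dblBasic E ρ K p q) : ψ - φ ∈ dblBasic E ρ K p q := by
  have h := add_mem_dblBasic hψ (smul_mem_dblBasic (-1) hφ)
  rwa [neg_one_smul, ← sub_eq_add_neg] at h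

variable [FiniteDimensional ℝ E] [FiniteDimensional ℝ V] [LieGroup 𝓘(ℝ, E) ∞ G]
  [MeasurableSpace G] [BorelSpace G] [CompactSpace K]

theorem hK_zero {p q : ℕ} : hK K (0 : Dbl E G V (p + 1) q) = 0 := by
  funext y ξ
  simp [hK]

variable (ρ K) in
/-- The solution `ψ` of `(1 + d h) ψ = χ`, by recursion on the form degree. -/
def solveDh (χ : Fam E G V) : (q p : ℕ) → Dbl E G V p q
  | 0, p => χ p 0
  | q + 1, p => χ p (q + 1) - dVer ρ (hK K (solveDh χ q (p + 1)))

/-- In form degree `q + 1` the equation involves `ψ` only in degrees `q + 1` and `q`, and in degree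
zero it reads `ψ = χ`. Uniqueness thus holds for arbitrary families, basic or not. -/
theorem eq_solveDh {ψ χ : Fam E G V} (h : oneAddDh ρ K ψ = χ) (q p : ℕ) :
    ψ p q = solveDh ρ K χ q p := by
  induction q generalizing p with
  | zero => simp [← h, oneAddDh, dh, solveDh]
  | succ q ih =>
    rw [solveDh, ← ih, ← h]
    exact (add_sub_cancel_right _ _).symm

theorem oneAddDh_solveDh (χ : Fam E G V) : oneAddDh ρ K (fun p q => solveDh ρ K χ q p) = χ := by
  funext p q
  cases q <;> simp [oneAddDh, dh, solveDh]

theorem solveDh_mem (hρ : SmoothRep E ρ) {n : ℕ} {χ : Fam E G V} (hχ : χ ∈ totBasic E ρ K n) :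
    (fun p q => solveDh ρ K χ q p) ∈ totBasic E ρ K n := by
  intro p q
  induction q generalizing p with
  | zero => exact hχ p 0
  | succ q ih =>
    refine ⟨sub_mem_dblBasic (hχ p (q + 1)).1 (dVer_mem_dblBasic hρ (hK_mem_dblBasic (ih _).1)),
      fun h => ?_⟩
    change χ p (q + 1) - dVer ρ (hK K (solveDh ρ K χ q (p + 1))) = 0
    rw [(hχ p (q + 1)).2 h, show solveDh ρ K χ q (p + 1) = 0 from (ih (p + 1)).2 (by omega), hK_zero, dVer_zero, sub_zero]

theorem oneAddDh_mem (hρ : SmoothRep E ρ) {n : ℕ} {ψ : Fam E G V} (hψ : ψ ∈ totBasic E ρ K n) :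
    oneAddDh ρ K ψ ∈ totBasic E ρ K n := by
  intro p q
  cases q with
  | zero => simpa [oneAddDh, dh] using hψ p 0
  | succ q =>
    refine ⟨add_mem_dblBasic (hψ p (q + 1)).1
      (dVer_mem_dblBasic hρ (hK_mem_dblBasic (hψ _ _).1)), fun h => ?_⟩
    change ψ p (q + 1) + dVer ρ (hK K (ψ (p + 1) q)) = 0
    rw [(hψ p (q + 1)).2 h, (hψ (p + 1) q).2 (by omega), hK_zero, dVer_zero, add_zero]

theorem bijOn_oneAddDh (hρ : SmoothRep E ρ) (n : ℕ) :
    Set.BijOn (oneAddDh ρ K) (totBasic E ρ K n) (totBasic E ρ K n) :=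
  ⟨fun _ => oneAddDh_mem hρ,
    fun ψ _ φ _ h => by
      funext p q
      exact (eq_solveDh h q p).trans (eq_solveDh rfl q p).symm,
    fun χ hχ => ⟨_, solveDh_mem hρ hχ, oneAddDh_solveDh χ⟩⟩

theorem inBidegree_jAug_mem (hρ : SmoothRep E ρ) {p : ℕ} {f : (Fin p → G) → V}
    (hf : f ∈ groupCochains E G V p) : inBidegree p 0 (jAug E ρ f) ∈ totBasic E ρ K p := by
  intro p' q'
  by_cases hp : p' = p
  · subst hp
    by_cases hq : q' = 0
    · subst hq
      simp only [inBidegree, Pi.single_eq_same]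
      exact ⟨jAug_mem_dblBasic hρ hf, fun h => (h rfl).elim⟩
    · simp only [inBidegree, Pi.single_eq_same, Pi.single_eq_of_ne hq]
      exact ⟨zero_mem_dblBasic, fun _ => trivial⟩
  · simp only [inBidegree, Pi.single_eq_of_ne hp, Pi.zero_apply]
    exact ⟨zero_mem_dblBasic, fun _ => trivial⟩

/-- The staircase of elements that computes `VE_{G/K} f`. -/
theorem exists_staircase (hρ : SmoothRep E ρ) {p : ℕ} {f : (Fin p → G) → V}
    (hf : f ∈ groupCochains E G V p) :
    ∃ Ψ : Fam E G V, (∀ n m, Ψ n m ∈ dblBasic E ρ K n m) ∧ Ψ p 0 = jAug E ρ f ∧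
      (∀ n m, Ψ n (m + 1) = -dVer ρ (hK K (Ψ (n + 1) m))) ∧ VE E ρ K f = prK K (Ψ 0 p) := by
  have hχ := inBidegree_jAug_mem (K := K) hρ hf
  -- Since `j f` lies in the image, `Function.invFunOn` returns a true preimage rather than a
  -- default value.
  have hs := (bijOn_oneAddDh (K := K) hρ p).surjOn hχ
  have h := eq_solveDh (Function.invFunOn_eq hs)
  refine ⟨_, fun n m => (Function.invFunOn_mem hs n m).1, ?_, fun n m => ?_, rfl⟩
  · rw [h]
    simp [solveDh, inBidegree]
  · rw [h, h, solveDh]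
    have h0 : inBidegree p 0 (jAug E ρ f) n (m + 1) = 0 := by
      by_cases hp : n = p
      · subst hp
        simp [inBidegree]
      · simp [inBidegree, Pi.single_eq_of_ne hp]
    rw [h0, zero_sub]

end TotalComplex

/-! ### Commuting the averages with the differentials -/

section Shifts

variable {E : Type*} [NormedAddCommGroup E] [NormedSpace ℝ E]
  {G : Type*} [TopologicalSpace G] [ChartedSpace E G] [Group G]
  {V : Type*} [NormedAddCommGroup V] [NormedSpace ℝ V]
  {ρ : Representation ℝ G V} {K : Subgroup G}

/-- The map of `G^p` underlying `act`. -/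
def shift {p : ℕ} (i : ℕ) (a : G) (g : Fin p → G) : Fin p → G := fun l =>
  if l.val + 1 = i then g l * a else if l.val = i then a⁻¹ * g l else g l

/-- The map of `G^p` underlying `diagAct`. -/
def diagShift {p : ℕ} (j : ℕ) (a : G) (g : Fin p → G) : Fin p → G := fun l =>
  if l.val + 1 < j then g l else if l.val + 1 = j then g l * a else a⁻¹ * g l * a

theorem act_of_ne {p : ℕ} {i : Fin (p + 1)} (hi : i ≠ Fin.last p) (a : G) (f : (Fin p → G) → V)
    (g : Fin p → G) : act ρ i a f g = f (shift i.val a g) :=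
  if_neg hi

theorem act_last {p : ℕ} (a : G) (f : (Fin p → G) → V) (g : Fin p → G) :
    act ρ (Fin.last p) a f g = ρ a (f (shift p a g)) :=
  if_pos rfl

/-- For `i < j`, action `i` right multiplies `g_i`, which diagonal action `j` leaves alone, and left
multiplies `g_{i+1}`, which diagonal action `j` at most right multiplies. -/
theorem shift_diagShift {p i j : ℕ} (h : i + 1 ≤ j) (a b : G) (g : Fin p → G) :
    shift i b (diagShift j a g) = diagShift j a (shift i b g) := by
  funext l
  simp only [shift, diagShift]
  split_ifs <;> first | omega | simp only [mul_assoc]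

variable [LieGroup 𝓘(ℝ, E) ∞ G] {F : Type*} [NormedAddCommGroup F] [NormedSpace ℝ F] {H : Type*}
  [TopologicalSpace H] {J : ModelWithCorners ℝ F H} {N : Type*} [TopologicalSpace N]
  [ChartedSpace H N]

theorem contMDiff_shift {p : ℕ} (i : ℕ) {α : N → G} {γ : N → Fin p → G}
    (hα : ContMDiff J 𝓘(ℝ, E) ∞ α) (hγ : ContMDiff J (powModel E p) ∞ γ) :
    ContMDiff J (powModel E p) ∞ fun x => shift i (α x) (γ x) := by
  refine contMDiff_powModel fun l => ?_
  have h : ContMDiff J 𝓘(ℝ, E) ∞ fun x => γ x l := (contMDiff_eval l).comp hγ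
  simp only [shift]
  split_ifs
  exacts [h.mul hα, hα.inv.mul h, h]

theorem contMDiff_diagShift {p : ℕ} (j : ℕ) {α : N → G} {γ : N → Fin p → G}
    (hα : ContMDiff J 𝓘(ℝ, E) ∞ α) (hγ : ContMDiff J (powModel E p) ∞ γ) :
    ContMDiff J (powModel E p) ∞ fun x => diagShift j (α x) (γ x) := by
  refine contMDiff_powModel fun l => ?_
  have h : ContMDiff J 𝓘(ℝ, E) ∞ fun x => γ x l := (contMDiff_eval l).comp hγ
  simp only [diagShift]
  split_ifs
  exacts [h, h.mul hα, (hα.inv.mul h).mul hα]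

theorem contMDiff_diagAct (hρ : SmoothRep E ρ) {p : ℕ} (j : ℕ) {φ : (Fin p → G) → V}
    (hφ : φ ∈ groupCochains E G V p) : ContMDiff ((powModel E p).prod 𝓘(ℝ, E)) 𝓘(ℝ, V) ∞
      fun z : (Fin p → G) × G => diagAct ρ j z.2 φ z.1 :=
  hρ.comp contMDiff_snd (ContMDiff.comp hφ (contMDiff_diagShift j contMDiff_snd contMDiff_fst))

theorem contMDiff_act (hρ : SmoothRep E ρ) {p : ℕ} (i : Fin (p + 1)) {φ : (Fin p → G) → V}
    (hφ : φ ∈ groupCochains E G V p) : ContMDiff ((powModel E p).prod 𝓘(ℝ, E)) 𝓘(ℝ, V) ∞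
      fun z : (Fin p → G) × G => act ρ i z.2 φ z.1 := by
  have h : ContMDiff ((powModel E p).prod 𝓘(ℝ, E)) 𝓘(ℝ, V) ∞
      fun z : (Fin p → G) × G => φ (shift i.val z.2 z.1) :=
    ContMDiff.comp hφ (contMDiff_shift i contMDiff_snd contMDiff_fst)
  by_cases hi : i = Fin.last p
  · subst hi
    simp only [act_last]
    exact hρ.comp contMDiff_snd h
  · simp only [act_of_ne hi]
    exact h

variable [FiniteDimensional ℝ E] [FiniteDimensional ℝ V]

theorem contMDiff_dIter (hρ : SmoothRep E ρ) {p : ℕ} {f : (Fin p → G) → V}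
    (hf : f ∈ groupCochains E G V p) (m : ℕ) (ξ : Fin m → LieAlg E G) :
    ContMDiff (powModel E p) 𝓘(ℝ, V) ∞ fun g => dIter E ρ f m g ξ := by
  induction m with
  | zero => exact hf
  | succ m ih => exact contMDiff_dCE _ (fun φ hφ => contMDiff_diagAct hρ _ hφ) ih ξ

variable [MeasurableSpace G] [BorelSpace G] [CompactSpace K]

theorem avAt_mem (hρ : SmoothRep E ρ) {p : ℕ} (i : Fin (p + 1)) {φ : (Fin p → G) → V}
    (hφ : φ ∈ groupCochains E G V p) : avAt E ρ K i φ ∈ groupCochains E G V p :=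
  contMDiff_integral (haarK E K) (contMDiff_act hρ i hφ) continuous_subtype_val

variable (E ρ K) in
/-- `Av^{(n)} ∘ ⋯ ∘ Av^{(p)}`. -/
def avFrom {p : ℕ} (f : (Fin p → G) → V) (n : ℕ) : (Fin p → G) → V :=
  ((List.finRange (p + 1)).drop n).foldr (avAt E ρ K) f

theorem avFrom_mem (hρ : SmoothRep E ρ) {p : ℕ} {f : (Fin p → G) → V}
    (hf : f ∈ groupCochains E G V p) (n : ℕ) : avFrom E ρ K f n ∈ groupCochains E G V p := by
  unfold avFrom
  induction (List.finRange (p + 1)).drop n with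
  | nil => exact hf
  | cons i L ih => exact avAt_mem hρ i ih

theorem avFrom_fin {p : ℕ} (f : (Fin p → G) → V) (i : Fin (p + 1)) :
    avFrom E ρ K f i.val = avAt E ρ K i (avFrom E ρ K f (i.val + 1)) := by
  rw [avFrom, List.drop_eq_getElem_cons (by simpa using Nat.lt_succ_iff.1 i.isLt)]
  simp [avFrom]

theorem avFrom_add_one {p : ℕ} (f : (Fin p → G) → V) : avFrom E ρ K f (p + 1) = f := by
  rw [avFrom, List.drop_eq_nil_of_le (by simp)]
  rfl

theorem bracketTerm_integral {X : Type*} [MeasurableSpace X] {μ : Measure X} {q : ℕ}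
    {α : X → Cochain E G V q} (hi : ∀ ξ, Integrable (fun x => α x ξ) μ)
    (ξ : Fin (q + 1) → LieAlg E G) :
    bracketTerm (fun ζ => ∫ x, α x ζ ∂μ) ξ = ∫ x, bracketTerm (α x) ξ ∂μ := by
  cases q with
  | zero => simp [bracketTerm]
  | succ q =>
    simp only [bracketTerm]
    have h : ∀ (j : Fin (q + 2)) (i : Fin (q + 1)), Integrable (fun x => if i.castSucc < j then
        (-1 : ℝ) ^ (i.val + j.val) •
          α x (Fin.cons ⁅ξ i.castSucc, ξ j⁆ (i.removeNth (j.removeNth ξ))) else 0) μ := by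
      intro j i
      split_ifs
      · exact (hi _).smul _
      · exact integrable_zero _ _ _
    rw [integral_finsetSum _ fun j _ => integrable_finsetSum _ fun i _ => h j i]
    refine Finset.sum_congr rfl fun j _ => ?_
    rw [integral_finsetSum _ fun i _ => h j i]
    refine Finset.sum_congr rfl fun i _ => ?_
    split_ifs
    · exact (integral_smul _ _).symm
    · exact integral_zero _ _ |>.symm

/-- Commuting actions, together with differentiation under the integral. For `i ≠ p` the action
touches only the arguments, so the average is a plain integral over shifted points. -/
theorem infAct_avAt (hρ : SmoothRep E ρ) {p j : ℕ} {i : Fin (p + 1)} (hij : i.val + 1 ≤ j)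
    (hi : i ≠ Fin.last p) {φ : (Fin p → G) → V} (hφ : φ ∈ groupCochains E G V p)
    (ξ : LieAlg E G) (g : Fin p → G) :
    infAct (diagAct ρ j) ξ (avAt E ρ K i φ) g =
      ∫ k : K, infAct (diagAct ρ j) ξ φ (shift i.val (k : G) g) ∂(haarK E K) := by
  have hc : ∀ g : Fin p → G, Integrable (fun k : K => φ (shift i.val (k : G) g)) (haarK E K) :=
    fun g => integrable_of_continuous _ ((ContMDiff.comp hφ (contMDiff_shift (E := E) i
      contMDiff_id (contMDiff_const (c := g)))).continuous.comp continuous_subtype_val)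
  have h : (fun a : G => diagAct ρ j a (avAt E ρ K i φ) g) =
      fun a : G => ∫ k : K, diagAct ρ j a φ (shift i.val (k : G) g) ∂(haarK E K) := by
    funext a
    change ρ a (∫ k : K, act ρ i (k : G) φ (diagShift j a g) ∂(haarK E K)) = _
    simp only [act_of_ne hi]
    rw [map_integral _ (hc _)]
    refine integral_congr_ae (.of_forall fun k => ?_)
    simp only [shift_diagShift hij]
    rfl
  refine (congrArg (fun f : G → V => (mfderiv 𝓘(ℝ, E) 𝓘(ℝ, V) f 1 ξ : V)) h).trans ?_
  refine mfderiv_one_integral (haarK E K)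
    (φ := fun a b => diagAct ρ j a φ (shift i.val b g)) ?_ continuous_subtype_val ξ
  exact (contMDiff_diagAct hρ j hφ).comp
    ((contMDiff_shift i contMDiff_snd contMDiff_const).prodMk contMDiff_fst)

theorem dCE_avAt (hρ : SmoothRep E ρ) {p j q : ℕ} {i : Fin (p + 1)} (hij : i.val + 1 ≤ j)
    (hi : i ≠ Fin.last p) {η : (Fin p → G) → Cochain E G V q}
    (hη : ∀ ξ, (fun g => η g ξ) ∈ groupCochains E G V p) (g : Fin p → G)
    (ξ : Fin (q + 1) → LieAlg E G) :
    dCE (diagAct ρ j) (fun g ζ => avAt E ρ K i (fun y => η y ζ) g) g ξ =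
      avAt E ρ K i (fun y => dCE (diagAct ρ j) η y ξ) g := by
  have hc : ∀ φ ∈ groupCochains E G V p,
      Integrable (fun k : K => φ (shift i.val (k : G) g)) (haarK E K) :=
    fun φ hφ => integrable_of_continuous _ ((ContMDiff.comp hφ (contMDiff_shift (E := E) i
      contMDiff_id (contMDiff_const (c := g)))).continuous.comp continuous_subtype_val)
  have h1 : ∀ l : Fin (q + 1), Integrable (fun k : K => (-1 : ℝ) ^ l.val •
      infAct (diagAct ρ j) (ξ l) (fun y => η y (l.removeNth ξ)) (shift i.val (k : G) g))
      (haarK E K) := fun l => Integrable.smul _ (hc _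
    (contMDiff_mfderiv_one (φ := fun x a => diagAct ρ j a (fun y => η y (l.removeNth ξ)) x)
      (contMDiff_diagAct hρ j (hη _)) (ξ l)))
  have h2 := hc _ (contMDiff_bracketTerm hη ξ)
  have h3 : bracketTerm (fun ζ => avAt E ρ K i (fun y => η y ζ) g) ξ =
      ∫ k : K, bracketTerm (η (shift i.val (k : G) g)) ξ ∂(haarK E K) := by
    simp only [avAt, act_of_ne hi]
    exact bracketTerm_integral (fun ζ => hc _ (hη ζ)) ξ
  have h4 : avAt E ρ K i (fun y => dCE (diagAct ρ j) η y ξ) g =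
      ∫ k : K, dCE (diagAct ρ j) η (shift i.val (k : G) g) ξ ∂(haarK E K) := by
    simp only [avAt, act_of_ne hi]
  rw [h4]
  refine Eq.trans ?_ (integral_add (integrable_finsetSum Finset.univ fun l _ => h1 l) h2).symm
  rw [integral_finsetSum Finset.univ fun l _ => h1 l]
  refine congrArg₂ (· + ·) (Finset.sum_congr rfl fun l _ => ?_) h3
  exact (congrArg _ (infAct_avAt hρ hij hi (hη _) (ξ l) g)).trans (integral_smul _ _).symm

/-- The bound `i + m ≤ p` says that every differential applied, namely `d^{(p-m+1)}, …, d^{(p)}`,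
has index larger than `i`. -/
theorem dIter_avAt (hρ : SmoothRep E ρ) {p : ℕ} {f : (Fin p → G) → V}
    (hf : f ∈ groupCochains E G V p) (i : Fin (p + 1)) {m : ℕ} (him : i.val + m ≤ p)
    (g : Fin p → G) (ξ : Fin m → LieAlg E G) :
    dIter E ρ (avAt E ρ K i f) m g ξ = avAt E ρ K i (fun y => dIter E ρ f m y ξ) g := by
  induction m generalizing g with
  | zero => rfl
  | succ m ih =>
    have hi : i ≠ Fin.last p := fun h => by
      have : i.val = p := by simp [h]
      omega
    have h : dIter E ρ (avAt E ρ K i f) m =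
        fun g ζ => avAt E ρ K i (fun y => dIter E ρ f m y ζ) g := by
      funext g ζ
      exact ih (by omega) g ζ
    rw [dIter, h]
    exact dCE_avAt hρ (by omega) hi (contMDiff_dIter hρ hf m) g ξ

end Shifts

/-! ### Descending the staircase -/

section Formula

variable {E : Type*} [NormedAddCommGroup E] [NormedSpace ℝ E]
  {G : Type*} [TopologicalSpace G] [ChartedSpace E G] [Group G]
  {V : Type*} [NormedAddCommGroup V] [NormedSpace ℝ V]
  {ρ : Representation ℝ G V} {K : Subgroup G}

/-- The point `(g_1, …, g_n, x, e, …, e)` of `G^p`. -/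
def padded (p : ℕ) {n : ℕ} (g : Fin n → G) (x : G) : Fin p → G := fun l =>
  if h : l.val < n then g ⟨l.val, h⟩ else if l.val = n then x else 1

/-- The trailing entries are conjugated, and `a⁻¹ e a = e`. -/
theorem diagShift_padded {p n : ℕ} (g : Fin n → G) (x a : G) :
    diagShift (n + 1) a (padded p g x) = padded p g (x * a) := by
  funext l
  simp only [diagShift, padded, add_lt_add_iff_right, add_left_inj]
  split_ifs <;> simp

/-- This matches the point at which `h` evaluates its argument with an action on `G^p`: the trailing
entry `e` after `x` absorbs the factor `a`. -/
theorem shift_padded {p n : ℕ} (g : Fin n → G) (x a : G) :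
    shift (n + 1) a⁻¹ (padded p g x) =
      padded p (Fin.snoc g (x * a⁻¹) : Fin (n + 1) → G) a := by
  funext l
  simp only [shift, padded, add_left_inj, inv_inv]
  rcases lt_trichotomy l.val n with h | h | h
  · have h1 : l.val ≠ n := h.ne
    have h2 : l.val ≠ n + 1 := by omega
    have h3 : l.val < n + 1 := by omega
    simp only [h, h1, h2, h3, if_false, dif_pos]
    exact (Fin.snoc_castSucc (α := fun _ => G) (x * a⁻¹) g ⟨l.val, h⟩).symm
  · have h3 : l.val < n + 1 := by omega
    have h4 : (⟨l.val, h3⟩ : Fin (n + 1)) = Fin.last n := Fin.ext h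
    simp only [h3, dif_pos, h4]
    simp [h, Fin.snoc_last]
  · have h1 : ¬ l.val < n := by omega
    have h2 : l.val ≠ n := by omega
    have h3 : ¬ l.val < n + 1 := by omega
    simp [h1, h2, h3]

theorem padded_self {p : ℕ} (g : Fin p → G) (x : G) : padded p g x = g := by
  funext l
  simp [padded]

theorem shift_zero_padded {p : ℕ} (a : G) (g : Fin 0 → G) :
    shift 0 a⁻¹ (fun _ => 1 : Fin p → G) = padded p g a := by
  funext l
  simp [shift, padded]

/-- The bridge between the double complex and `C^∞(G^p, V)`: restriction to padded points
intertwines the diagonal action with right translation, hence also the differentials. -/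
theorem dCE_diagAct_padded {p n q : ℕ} (η : (Fin p → G) → Cochain E G V q) (g : Fin n → G)
    (x : G) : dCE (diagAct ρ (n + 1)) η (padded p g x) =
      dCE (rightAct ρ) (fun y : (Fin n → G) × G => η (padded p y.1 y.2)) (g, x) := by
  have h : ∀ (φ : (Fin p → G) → V) (a : G), diagAct ρ (n + 1) a φ (padded p g x) =
      rightAct ρ a (fun y : (Fin n → G) × G => φ (padded p y.1 y.2)) (g, x) := by
    intro φ a
    change ρ a (φ (diagShift (n + 1) a (padded p g x))) = _
    rw [diagShift_padded]
    rfl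
  funext ξ
  refine congrArg₂ (· + ·) (Finset.sum_congr rfl fun i _ => congrArg _ ?_) rfl
  exact congrArg (fun f : G → V => (mfderiv 𝓘(ℝ, E) 𝓘(ℝ, V) f 1 (ξ i) : V)) (funext (h _))

theorem bracketTerm_smul {q : ℕ} (c : ℝ) (α : Cochain E G V q) :
    bracketTerm (c • α) = c • bracketTerm α := by
  funext ξ
  cases q with
  | zero => simp [bracketTerm]
  | succ q =>
    simp only [bracketTerm, Pi.smul_apply, Finset.smul_sum, smul_ite, smul_zero, smul_comm c]

variable [LieGroup 𝓘(ℝ, E) ∞ G] [FiniteDimensional ℝ E] [FiniteDimensional ℝ V]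
  [MeasurableSpace G] [BorelSpace G] [CompactSpace K]

theorem dCE_rightAct_smul (hρ : SmoothRep E ρ) {n q : ℕ} (c : ℝ) {η : Dbl E G V n q}
    (hη : ∀ ξ, ContMDiff ((powModel E n).prod 𝓘(ℝ, E)) 𝓘(ℝ, V) ∞ fun y => η y ξ) :
    dCE (rightAct ρ) (c • η) = c • dCE (rightAct ρ) η := by
  have h : ∀ (φ : (Fin n → G) × G → V),
      ContMDiff ((powModel E n).prod 𝓘(ℝ, E)) 𝓘(ℝ, V) ∞ φ → ∀ (ξ : LieAlg E G) y,
      infAct (rightAct ρ) ξ (fun y => c • φ y) y = c • infAct (rightAct ρ) ξ φ y := by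
    intro φ hφ ξ y
    have h1 : (fun a : G => rightAct ρ a (fun y => c • φ y) y) =
        c • fun a : G => rightAct ρ a φ y := by
      funext a
      exact map_smul _ _ _
    refine (congrArg (fun f : G → V => (mfderiv 𝓘(ℝ, E) 𝓘(ℝ, V) f 1 ξ : V)) h1).trans ?_
    exact congrArg (fun L => L ξ)
      ((mdifferentiableAt_rightAct hρ hφ y).hasMFDerivAt.const_smul c).mfderiv
  funext y ξ
  refine (congrArg₂ (· + ·) (Finset.sum_congr rfl fun i _ => (congrArg _
    (h _ (hη _) (ξ i) y)).trans (smul_comm _ _ _)) (congrFun (bracketTerm_smul c (η y)) ξ)).trans ?_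
  refine Eq.trans ?_ (smul_add _ _ _).symm
  exact congrArg₂ (· + ·) Finset.smul_sum.symm rfl

theorem contMDiff_padded {p n : ℕ} :
    ContMDiff ((powModel E n).prod 𝓘(ℝ, E)) (powModel E p) ∞
      fun y : (Fin n → G) × G => padded p y.1 y.2 := by
  refine contMDiff_powModel fun l => ?_
  simp only [padded]
  split_ifs
  exacts [(contMDiff_eval _).comp contMDiff_fst, contMDiff_snd, contMDiff_const]

/-- One step down the staircase: from the average of `Ψ^{n+1,m}` to `Ψ^{n,m+1}`. -/
theorem staircase_step (hρ : SmoothRep E ρ) {p n m : ℕ} (hp : n + 1 + m = p)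
    {F : (Fin p → G) → V} (hF : F ∈ groupCochains E G V p)
    {ψ : Dbl E G V (n + 1) m}
    (hψ : ∀ g x ξ, ∫ k : K, ψ (Fin.snoc g (x * (k : G)⁻¹), (k : G)) ξ ∂(haarK E K) =
      dIter E ρ F m (padded p g x) ξ) (g : Fin n → G) (x : G) :
    (-dVer ρ (hK K ψ)) (g, x) = dIter E ρ F (m + 1) (padded p g x) := by
  have h1 : hK K ψ = (-1 : ℝ) ^ (n + 1) •
      fun y : (Fin n → G) × G => dIter E ρ F m (padded p y.1 y.2) := by
    funext y ξ
    exact congrArg (fun v => (-1 : ℝ) ^ (n + 1) • v) (hψ y.1 y.2 ξ)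
  -- The signs of `d` and `h` combine to `-1`, which cancels the minus sign of the staircase.
  have h2 : (-1 : ℝ) ^ n * (-1) ^ (n + 1) = -1 := by
    rw [pow_succ, ← mul_assoc, ← mul_pow]
    norm_num
  have h3 : p - m = n + 1 := by omega
  rw [dVer, h1, dCE_rightAct_smul (η := fun y : (Fin n → G) × G =>
      dIter E ρ F m (padded p y.1 y.2)) hρ _
      fun ξ => (contMDiff_dIter hρ hF m ξ).comp contMDiff_padded,
    smul_smul, h2, neg_one_smul, neg_neg, dIter, h3, dCE_diagAct_padded]

/-- After `k ↦ k⁻¹` the integral is `Av^{(n+1)}` at the padded point, and it passes through the `m +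
1` differentials because their indices exceed `n + 1`. -/
theorem integral_dIter_padded (hρ : SmoothRep E ρ) {p n m : ℕ} (hp : n + 1 + m < p)
    {F : (Fin p → G) → V} (hF : F ∈ groupCochains E G V p) (i : Fin (p + 1)) (hi : i.val = n + 1)
    (g : Fin n → G) (x : G) (ξ : Fin (m + 1) → LieAlg E G) :
    ∫ k : K, dIter E ρ F (m + 1) (padded p (Fin.snoc g (x * (k : G)⁻¹) : Fin (n + 1) → G) k) ξ
      ∂(haarK E K) = dIter E ρ (avAt E ρ K i F) (m + 1) (padded p g x) ξ := by
  have hl : i ≠ Fin.last p := fun h => by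
    have : i.val = p := by simp [h]
    omega
  rw [dIter_avAt hρ hF i (by omega), avAt]
  refine Eq.trans ?_ (integral_haarK_inv K _)
  refine integral_congr_ae (.of_forall fun k => ?_)
  simp only [act_of_ne hl, hi, Subgroup.coe_inv, shift_padded]

/-- Top of the staircase: the factor `k⁻¹` that `j` applies to values is exactly the extra action on
`V` in the last of the `p + 1` actions. -/
theorem integral_jAug {n : ℕ} (f : (Fin (n + 1) → G) → V) (g : Fin n → G) (x : G)
    (ξ : Fin 0 → LieAlg E G) :
    ∫ k : K, jAug E ρ f (Fin.snoc g (x * (k : G)⁻¹), (k : G)) ξ ∂(haarK E K) =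
      avAt E ρ K (Fin.last (n + 1)) f (padded (n + 1) g x) := by
  refine Eq.trans ?_ (integral_haarK_inv K _)
  refine integral_congr_ae (.of_forall fun k => ?_)
  simp only [act_last, Subgroup.coe_inv, shift_padded, padded_self, jAug]

/-- The induction is run on averages because `h` sees `Ψ^{n+1,m}` only through them. Each step adds
one differential from `d` and one average from the next integral. -/
theorem integral_staircase (hρ : SmoothRep E ρ) {p : ℕ} {f : (Fin p → G) → V}
    (hf : f ∈ groupCochains E G V p) {Ψ : Fam E G V} (h0 : Ψ p 0 = jAug E ρ f)
    (hΨ : ∀ n m, Ψ n (m + 1) = -dVer ρ (hK K (Ψ (n + 1) m))) (m n : ℕ) (hp : n + 1 + m = p)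
    (g : Fin n → G) (x : G) (ξ : Fin m → LieAlg E G) :
    ∫ k : K, Ψ (n + 1) m (Fin.snoc g (x * (k : G)⁻¹), (k : G)) ξ ∂(haarK E K) =
      dIter E ρ (avFrom E ρ K f (n + 1)) m (padded p g x) ξ := by
  induction m generalizing n x with
  | zero =>
    obtain rfl : n + 1 = p := hp
    rw [h0, integral_jAug]
    have h := avFrom_fin (E := E) (ρ := ρ) (K := K) f (Fin.last (n + 1))
    rw [Fin.val_last, avFrom_add_one] at h
    rw [dIter, h]
  | succ m ih =>
    have hF := avFrom_mem (K := K) hρ hf (n + 2)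
    have h1 := staircase_step hρ (p := p) (n := n + 1) (by omega) hF
      fun g x => ih (n + 1) (by omega) g x
    have h2 := avFrom_fin (E := E) (ρ := ρ) (K := K) f (⟨n + 1, by omega⟩ : Fin (p + 1))
    rw [hΨ, h2, ← integral_dIter_padded hρ (by omega) hF _ rfl]
    simp only [h1]

theorem VE_mem (hρ : SmoothRep E ρ) {p : ℕ} {f : (Fin p → G) → V}
    (hf : f ∈ groupCochains E G V p) : VE E ρ K f ∈ lieBasic E ρ K p := by
  obtain ⟨Ψ, hmem, -, -, h⟩ := exists_staircase (K := K) hρ hf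
  rw [h]
  exact prK_mem_lieBasic (hmem 0 p)

theorem VE_eq_dIter (hρ : SmoothRep E ρ) {p : ℕ} {f : (Fin p → G) → V}
    (hf : f ∈ groupCochains E G V p) :
    VE E ρ K f = dIter E ρ (Av E ρ K f) p (fun _ => 1) := by
  obtain ⟨Ψ, -, h0, hΨ, h⟩ := exists_staircase (K := K) hρ hf
  have hAv : Av E ρ K f = avAt E ρ K 0 (avFrom E ρ K f 1) := avFrom_fin f 0
  rw [h]
  funext ξ
  cases p with
  | zero =>
    -- With no group arguments the only action is the one on `V`, so the projection of `j f` is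
    -- already `Av^{(0)} f`, up to inverting `k`.
    rw [hAv, h0, avFrom_add_one]
    refine Eq.trans ?_ (integral_haarK_inv K _)
    refine integral_congr_ae (.of_forall fun k => ?_)
    refine congrArg (ρ (k : G)⁻¹) (congrArg f (Subsingleton.elim _ _))
  | succ m =>
    have hF := avFrom_mem (K := K) hρ hf 1
    have h1 := staircase_step hρ (p := m + 1) (by omega) hF
      (integral_staircase hρ hf h0 hΨ m 0 (by omega))
    have hl : (0 : Fin (m + 2)) ≠ Fin.last (m + 1) := Fin.last_pos.ne
    -- The final integral, from the projection, is `Av^{(0)}` at `(e, …, e)`: action `0` of `k⁻¹`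
    -- moves this point to `(k, e, …, e)`.
    rw [hAv, dIter_avAt hρ hF 0 (by simp)]
    refine Eq.trans ?_ (integral_haarK_inv K _)
    refine integral_congr_ae (.of_forall fun k => ?_)
    simp only [hΨ, h1, act_of_ne hl, Subgroup.coe_inv, Fin.val_zero,
      shift_zero_padded _ (Fin.elim0 : Fin 0 → G)]

theorem act_one {p : ℕ} (i : Fin (p + 1)) (f : (Fin p → G) → V) : act ρ i 1 f = f := by
  funext g
  have h : shift i.val 1 g = g := by
    funext l
    simp [shift]
  by_cases hi : i = Fin.last p
  · subst hi
    rw [act_last, map_one, show shift p 1 g = g from h]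
    rfl
  · rw [act_of_ne hi, h]

theorem avAt_bot {p : ℕ} (i : Fin (p + 1)) (f : (Fin p → G) → V) :
    avAt E ρ (⊥ : Subgroup G) i f = f := by
  funext g
  have h : ∀ k : (⊥ : Subgroup G), act ρ i (k : G) f g = f g := fun k => by
    rw [Subgroup.mem_bot.1 k.2, act_one]
  simp only [avAt, h, integral_const, probReal_univ, one_smul]

theorem Av_bot {p : ℕ} (f : (Fin p → G) → V) : Av E ρ (⊥ : Subgroup G) f = f := by
  unfold Av
  induction List.finRange (p + 1) with
  | nil => rfl
  | cons i L ih => rw [List.foldr_cons, ih, avAt_bot]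

theorem Av_mem (hρ : SmoothRep E ρ) {p : ℕ} {f : (Fin p → G) → V}
    (hf : f ∈ groupCochains E G V p) : Av E ρ K f ∈ groupCochains E G V p :=
  avFrom_mem hρ hf 0

/-- Both sides are the same iterated differential at `(e, …, e)`, since averaging over the trivial
group does nothing. -/
theorem VE_eq_VE_bot (hρ : SmoothRep E ρ) {p : ℕ} {f : (Fin p → G) → V}
    (hf : f ∈ groupCochains E G V p) : VE E ρ K f = VE E ρ ⊥ (Av E ρ K f) := by
  rw [VE_eq_dIter hρ hf, VE_eq_dIter hρ (Av_mem hρ hf), Av_bot]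

end Formula

end VanEst

end

open scoped Manifold ContDiff in
open VanEst in
theorem theorem3p1
    {E : Type*} [NormedAddCommGroup E] [NormedSpace ℝ E] [FiniteDimensional ℝ E]
    {G : Type*} [TopologicalSpace G] [ChartedSpace E G] [Group G] [LieGroup 𝓘(ℝ, E) ∞ G]
    [MeasurableSpace G] [BorelSpace G]
    {V : Type*} [NormedAddCommGroup V] [NormedSpace ℝ V] [FiniteDimensional ℝ V]
    (ρ : Representation ℝ G V)
    (hρ : ContMDiff (𝓘(ℝ, E).prod 𝓘(ℝ, V)) 𝓘(ℝ, V) ∞ fun x : G × V => ρ x.1 x.2)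
    (K : Subgroup G) [CompactSpace K] :
    -- the operators restrict to the `K`-basic complexes
    (∀ p q : ℕ,
      (∀ ψ ∈ dblBasic E ρ K p q, dHor ψ ∈ dblBasic E ρ K (p + 1) q) ∧
      (∀ ψ ∈ dblBasic E ρ K p q, dVer ρ ψ ∈ dblBasic E ρ K p (q + 1)) ∧
      (∀ ψ ∈ dblBasic E ρ K (p + 1) q, hK K ψ ∈ dblBasic E ρ K p q) ∧
      (∀ α ∈ lieBasic E ρ K q, iAug α ∈ dblBasic E ρ K 0 q) ∧
      (∀ ψ ∈ dblBasic E ρ K 0 q, prK K ψ ∈ lieBasic E ρ K q) ∧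
      (∀ f ∈ groupCochains E G V p, jAug E ρ f ∈ dblBasic E ρ K p 0)) ∧
    -- `h` is a horizontal homotopy: `h δ + δ h = 1 - i p`, and `p i = 1`
    (∀ p q : ℕ, ∀ ψ ∈ dblBasic E ρ K (p + 1) q, hK K (dHor ψ) + dHor (hK K ψ) = ψ) ∧
    (∀ q : ℕ, ∀ ψ ∈ dblBasic E ρ K 0 q, hK K (dHor ψ) = ψ - iAug (prK K ψ)) ∧
    (∀ q : ℕ, ∀ α ∈ lieBasic E ρ K q, prK K (iAug α) = α) ∧
    -- `1 + d h` is invertible on the total complex, in every degree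
    (∀ n : ℕ, Set.BijOn (oneAddDh ρ K) (totBasic E ρ K n) (totBasic E ρ K n)) ∧
    -- the van Est differentiation and its formula
    (∀ p : ℕ, ∀ f ∈ groupCochains E G V p,
      VE E ρ K f ∈ lieBasic E ρ K p ∧
      Av E ρ K f ∈ groupCochains E G V p ∧
      VE E ρ K f = dIter E ρ (Av E ρ K f) p (fun _ => 1) ∧
      VE E ρ K f = VE E ρ ⊥ (Av E ρ K f)) := by
  exact ⟨fun p q => ⟨fun _ => dHor_mem_dblBasic, fun _ => dVer_mem_dblBasic hρ,
      fun _ => hK_mem_dblBasic, fun _ => iAug_mem_dblBasic, fun _ => prK_mem_lieBasic,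
      fun _ => jAug_mem_dblBasic hρ⟩,
    fun _ _ _ => hK_dHor_add, fun _ _ => hK_dHor_zero, fun _ α _ => prK_iAug α,
    bijOn_oneAddDh hρ,
    fun p f hf => ⟨VE_mem hρ hf, Av_mem hρ hf, VE_eq_dIter hρ hf, VE_eq_VE_bot hρ hf⟩⟩
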